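/- Let $\mathbb{T}$ be the unit circle with the arc length measure (total mass $2\pi$) and let $t>0$. For a probability measure $\mu$ on $\mathbb{T}$ put $\psi_\mu(z)=\int_{\mathbb{T}}\frac{uz}{1-uz}\,\mu(\mathrm{d}u)$ for $|z|<1$; if $\int_{\mathbb{T}}u\,\mu(\mathrm{d}u)\neq 0$, then $\psi_\mu$ has an analytic local inverse $\psi_\mu^{-1}$ at the origin, and the $S$-transform of $\mu$ is $S_\mu(w)=\frac{1+w}{w}\,\psi_\mu^{-1}(w)$ for small $w\neq 0$. The free unitary Poisson distribution $\Pi_t$ is the probability measure on $\mathbb{T}$ with nonzero first moment and with $S_{\Pi_t}(w)=\exp\{t/(w+\tfrac12)\}$ for all small $w\ne 0$. For $\ell\in\mathbb{N}$ let $$p_\ell(t)=1+\frac12\sum_{\substack{a,b,c\in\mathbb{N}_0,\ a\neq 0\\ a+b+c=\ell-1}}\frac{(\ell-1)!}{a!\,b!\,c!}\cdot\frac{(2\ell t)^a\,2^{a+b+1}(-1)^b}{(a-1)!\,(a+b)(a+b+1)}.$$ **Proposition.** (i) If $t>1$, then $\Pi_t$ is absolutely continuous with respect to arc length, and it has a continuous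 density $f$ given by the series $$f(\mathrm{e}^{\mathrm{i}\theta})=\frac1{2\pi}+\frac1\pi\sum_{\ell=1}^\infty \mathrm{e}^{-2\ell t}p_\ell(t)\cos(\ell\theta),\qquad \theta\in[-\pi,\pi],\qquad (1)$$ which converges uniformly on $[-\pi,\pi]$. (ii) If $0<t<1$, then $\Pi_t=(1-t)\delta_1+\Pi_t^*$ with a positive measure $\Pi_t^*$ that is absolutely continuous with respect to arc length and has a continuous density $f^*$ given by the series $$f^*(\mathrm{e}^{\mathrm{i}\theta})=\frac{t}{2\pi}+\frac1\pi\sum_{\ell=1}^\infty\left(\mathrm{e}^{-2\ell t}p_\ell(t)-1+t\right)\cos(\ell\theta),\qquad \theta\in[-\pi,\pi],$$ which converges uniformly on $[-\pi,\pi]$. (iii) If $t=1$, then $\Pi_1$ is absolutely continuous with respect to arc length and has a density $f$, continuous on $\mathbb{T}\setminus\{1\}$, given by the series (1) with $t=1$: the series converges to $f(\mathrm{e}^{\mathrm{i}\theta})$ for every $\theta\in[-\pi,\pi]\setminus\{0\}$, and for every $1\le p<3$ the function $\theta\mapsto f(\mathrm{e}^{\mathrm{i}\theta})$ belongs to $L^p[-\pi,\pi]$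 and the series converges to it in $L^p[-\pi,\pi]$. -/

import Mathlib

open MeasureTheory Filter Topology
open scoped ENNReal Nat

noncomputable section

namespace FreeUnitaryPoisson

/-- The circle carries its Borel `σ`-algebra. -/
instance instMeasurableSpaceCircle : MeasurableSpace Circle := borel Circle

instance instBorelSpaceCircle : BorelSpace Circle := ⟨rfl⟩

/-- The arc length measure on the unit circle (total mass `2π`). -/
def lengthMeasure : Measure Circle :=
  Measure.map Circle.exp ((volume : Measure ℝ).restrict (Set.Ioc (-Real.pi) Real.pi))

/-- The `ψ`-transform `ψ_μ(z) = ∫ u z / (1 - u z) μ(du)`, `|z| < 1`, of a measure on the circle. -/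
def psiTransform (μ : Measure Circle) (z : ℂ) : ℂ :=
  ∫ u : Circle, ((u : ℂ) * z) / (1 - (u : ℂ) * z) ∂μ

/-- `S` is (near the origin) the `S`-transform of `μ`, that is
`S(w) = ((1 + w) / w) * ψ_μ⁻¹(w)` for all sufficiently small `w ≠ 0`, where `ψ_μ⁻¹` is the
analytic local inverse of `ψ_μ` at the origin. -/
def HasSTransform (μ : Measure Circle) (S : ℂ → ℂ) : Prop :=
  ∃ χ : ℂ → ℂ, AnalyticAt ℂ χ 0 ∧ χ 0 = 0 ∧
    (∀ᶠ z in 𝓝 (0 : ℂ), χ (psiTransform μ z) = z) ∧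
    (∀ᶠ w in 𝓝 (0 : ℂ), psiTransform μ (χ w) = w) ∧
    (∀ᶠ w in 𝓝[≠] (0 : ℂ), S w = (1 + w) / w * χ w)

/-- `μ` is the free unitary Poisson distribution `Π_t`: the probability measure on the unit circle
with nonzero first moment whose `S`-transform is `exp (t / (w + 1/2))`. -/
structure IsFreeUnitaryPoisson (t : ℝ) (μ : Measure Circle) : Prop where
  isProbabilityMeasure : IsProbabilityMeasure μ
  firstMoment_ne_zero : ∫ u : Circle, (u : ℂ) ∂μ ≠ 0
  hasSTransform : HasSTransform μ (fun w => Complex.exp ((t : ℂ) / (w + 1 / 2)))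

/-- The polynomials `p_ℓ(t)`: one plus half the sum over all `a ≥ 1`, `b, c ≥ 0` with
`a + b + c = ℓ - 1` (here `a = x.1`, `b = y.1`, `c = y.2`) of
`(ℓ-1)! / (a! b! c!) * (2ℓt)^a 2^(a+b+1) (-1)^b / ((a-1)! (a+b) (a+b+1))`. -/
def momentPoly (ℓ : ℕ) (t : ℝ) : ℝ :=
  1 + 1 / 2 * ∑ x ∈ Finset.filter (fun x => x.1 ≠ 0) (Finset.HasAntidiagonal.antidiagonal (ℓ - 1)),
    ∑ y ∈ Finset.HasAntidiagonal.antidiagonal x.2,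
      ((ℓ - 1)! : ℝ) / ((x.1 ! : ℝ) * (y.1 ! : ℝ) * (y.2 ! : ℝ)) *
        ((2 * (ℓ : ℝ) * t) ^ x.1 * 2 ^ (x.1 + y.1 + 1) * (-1) ^ y.1 /
          (((x.1 - 1)! : ℝ) * ((x.1 : ℝ) + y.1) * ((x.1 : ℝ) + y.1 + 1)))

/-- Partial sum `1/(2π) + (1/π) ∑_{ℓ=1}^N e^{-2ℓt} p_ℓ(t) cos(ℓθ)`. -/
def cosineSum (t : ℝ) (N : ℕ) (θ : ℝ) : ℝ :=
  1 / (2 * Real.pi) + 1 / Real.pi * ∑ ℓ ∈ Finset.Icc 1 N,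
    Real.exp (-2 * (ℓ : ℝ) * t) * momentPoly ℓ t * Real.cos ((ℓ : ℝ) * θ)

/-- Partial sum `t/(2π) + (1/π) ∑_{ℓ=1}^N (e^{-2ℓt} p_ℓ(t) - 1 + t) cos(ℓθ)`. -/
def cosineSumStar (t : ℝ) (N : ℕ) (θ : ℝ) : ℝ :=
  t / (2 * Real.pi) + 1 / Real.pi * ∑ ℓ ∈ Finset.Icc 1 N,
    (Real.exp (-2 * (ℓ : ℝ) * t) * momentPoly ℓ t - 1 + t) * Real.cos ((ℓ : ℝ) * θ)

/-- The (positive) measure `ν` on the circle has density `f` with respect to arc length. -/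
structure HasLengthDensity (ν : Measure Circle) (f : Circle → ℝ) : Prop where
  measurable : Measurable f
  nonneg : ∀ z, 0 ≤ f z
  eq_withDensity : ν = lengthMeasure.withDensity (fun z => ENNReal.ofReal (f z))

end FreeUnitaryPoisson

end

namespace FreeUnitaryPoisson

/-! In the coordinate v = w/(1+w) the local inverse of ψ becomes X(v) = v exp(2t(1-v)/(1+v))
(`diskMap`), and ψ(X(v)) = v/(1-v) near 0. By Lagrange inversion, ℓ times the ℓ-th moment is the
integral of X(v)^(-ℓ)/(1-v)^2 over a small circle, divided by 2πi
(`IsFreeUnitaryPoisson.integral_pow`). Expanding the integrand in w identifies the moment with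
e^(-2ℓt) p_ℓ(t) (`contour_eq_moment`). The rest is the size of this integral for large ℓ: steepest
descent with explicit constants, governed by the critical points of X, the roots of (1+v)^2 = 4tv.

For t > 1, a circle of radius r with 1/t < r < 1 has |X| bounded below by a constant above 1, so the
moments decay geometrically (`summable_moment_of_one_lt`). For t < 1 the critical points are
conjugate on the unit circle, where |X| = 1. The circle with centre 1/4 through them has |X| ≥ 1,
with quadratic growth away from them, but it encloses the pole v = 1. The residue there accounts for
the mass 1-t of the atom, and a Gaussian estimate leaves O(ℓ^(-3/2)) (`exists_abs_moment_sub_le`).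
For t = 1 the critical points merge at v = 1 and X - 1 vanishes there to third order. The radius 1-ε
with ε of order ℓ^(-1/3) gives moments O(ℓ^(-2/3)) with differences O(ℓ^(-5/3))
(`exists_moment_one_bounds`).

Summable coefficients give uniform convergence when t ≠ 1. When t = 1, Abel summation gives
convergence off 1 and a bound of the partial sums by a multiple of |θ|^(-γ) for every γ in (1/3, 1]
(`exists_abs_trigSum_le`), which is where p < 3 comes from. The measure is recovered from its
moments by density of trigonometric polynomials, and positivity of the density is inherited from μ
(`eq_dirac_add_withDensity`). -/

/-! ### Power series coefficients as contour integrals in a changed variable -/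

theorem circleIntegral_zpow_mul_deriv_eq_zero {W W' : ℂ → ℂ} {c : ℂ} {r : ℝ} (hr : 0 ≤ r)
    (hW : ∀ v ∈ Metric.sphere c r, HasDerivAt W (W' v) v)
    (h0 : ∀ v ∈ Metric.sphere c r, W v ≠ 0) {n : ℤ} (hn : n ≠ -1) :
    ∮ v in C(c, r), W v ^ n * W' v = 0 := by
  have hn' : ((n + 1 : ℤ) : ℂ) ≠ 0 := by exact_mod_cast fun h => hn (by omega)
  refine circleIntegral.integral_eq_zero_of_hasDerivWithinAt (f := fun v => W v ^ (n + 1) / (n + 1 : ℤ))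
    hr fun v hv => ?_
  have h1 := (hasDerivAt_zpow (n + 1) (W v) (Or.inl (h0 v hv))).comp v (hW v hv)
  have h2 := h1.div_const ((n + 1 : ℤ) : ℂ)
  refine (h2.congr_deriv ?_).hasDerivWithinAt
  rw [add_sub_cancel_right]
  field_simp

/-- The integral of `F(W) W^{-ℓ-1} dW` over a circle on which `F(W) = ∑ C_k W^k`, and around which
`W` winds once about the origin, is `2πi C_ℓ`. -/
theorem circleIntegral_eq_coeff {C : ℕ → ℂ} {W W' F : ℂ → ℂ} {c : ℂ} {r R : ℝ} (hr : 0 ≤ r)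
    (hW : ∀ v ∈ Metric.sphere c r, HasDerivAt W (W' v) v)
    (hW' : ContinuousOn W' (Metric.sphere c r))
    (h0 : ∀ v ∈ Metric.sphere c r, W v ≠ 0)
    (hres : ∮ v in C(c, r), W v ^ (-1 : ℤ) * W' v = 2 * Real.pi * Complex.I)
    (hR : ∀ v ∈ Metric.sphere c r, ‖W v‖ ≤ R)
    (hsum : Summable fun k => ‖C k‖ * R ^ k)
    (hF : ∀ v ∈ Metric.sphere c r, HasSum (fun k => C k * W v ^ k) (F v)) (l : ℕ) :
    ∮ v in C(c, r), F v * (W v ^ (-(l : ℤ) - 1) * W' v) = 2 * Real.pi * Complex.I * C l := by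
  have hWc : ContinuousOn W (Metric.sphere c r) := fun v hv =>
    (hW v hv).continuousAt.continuousWithinAt
  have hWp : ∀ n : ℤ, ContinuousOn (fun v => W v ^ n * W' v) (Metric.sphere c r) := fun n =>
    (hWc.zpow₀ n fun v hv => Or.inl (h0 v hv)).mul hW'
  obtain ⟨M, hM⟩ := (isCompact_sphere c r).exists_bound_of_continuousOn (hWp (-(l : ℤ) - 1))
  have key : HasSum (fun k => ∮ v in C(c, r), C k * (W v ^ ((k : ℤ) + (-(l : ℤ) - 1)) * W' v))
      (∮ v in C(c, r), F v * (W v ^ (-(l : ℤ) - 1) * W' v)) := by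
    unfold circleIntegral
    have hms : ∀ θ : ℝ, circleMap c r θ ∈ Metric.sphere c r := circleMap_mem_sphere c hr
    have hdn : ∀ θ : ℝ, ‖deriv (circleMap c r) θ‖ = r := fun θ => by
      simp [deriv_circleMap, abs_of_nonneg hr]
    refine intervalIntegral.hasSum_integral_of_dominated_convergence
      (fun k _ => r * (‖C k‖ * R ^ k * M)) (fun k => ?_) (fun k => ?_) ?_ ?_ ?_
    · refine Continuous.aestronglyMeasurable ?_
      have h1 : Continuous (deriv (circleMap c r)) := by
        rw [show deriv (circleMap c r) = fun θ => circleMap 0 r θ * Complex.I from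
          funext fun θ => by simp [deriv_circleMap]]
        fun_prop
      exact h1.smul (continuous_const.mul
        ((hWp ((k : ℤ) + (-(l : ℤ) - 1))).comp_continuous (continuous_circleMap c r) hms))
    · refine Eventually.of_forall fun θ _ => ?_
      rw [norm_smul, hdn]
      dsimp only
      rw [zpow_add₀ (h0 _ (hms θ)), mul_assoc, norm_mul, norm_mul, zpow_natCast,
        norm_pow, ← mul_assoc ‖C k‖]
      refine mul_le_mul_of_nonneg_left (mul_le_mul ?_ (hM _ (hms θ)) (norm_nonneg _) ?_) hr
      · gcongr
        exact hR _ (hms θ)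
      · exact mul_nonneg (norm_nonneg _) (pow_nonneg ((norm_nonneg _).trans (hR _ (hms θ))) _)
    · exact Eventually.of_forall fun θ _ => (hsum.mul_right M).mul_left r
    · simp
    · refine Eventually.of_forall fun θ _ => ?_
      have := ((hF _ (hms θ)).mul_right
        (W (circleMap c r θ) ^ (-(l : ℤ) - 1) * W' (circleMap c r θ))).const_smul
        (deriv (circleMap c r) θ)
      refine this.congr_fun ?_
      intro k
      dsimp only
      rw [zpow_add₀ (h0 _ (hms θ)), zpow_natCast]
      ring_nf
  -- Every power of W other than -1, times W', has a primitive on the circle, so only k = l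
  -- survives.
  have h1 : ∀ k, k ≠ l →
      ∮ v in C(c, r), C k * (W v ^ ((k : ℤ) + (-(l : ℤ) - 1)) * W' v) = 0 := fun k hk => by
    rw [circleIntegral.integral_const_mul,
      circleIntegral_zpow_mul_deriv_eq_zero hr hW h0 (by omega), mul_zero]
  have h2 := (hasSum_single l h1).unique key
  rw [← h2, show (l : ℤ) + (-(l : ℤ) - 1) = -1 by ring, circleIntegral.integral_const_mul, hres,
    mul_comm]

/-! ### The power series expansion behind p_ℓ -/

/-- With `multichoose` the case a = 0 needs no separate treatment: only the term b = 0 is then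
nonzero. -/
theorem hasSum_multichoose_mul_pow {x : ℂ} (hx : ‖x‖ < 1) (a : ℕ) :
    HasSum (fun b : ℕ => (a.multichoose b : ℂ) * x ^ b) ((1 - x)⁻¹ ^ a) := by
  cases a with
  | zero =>
    have := hasSum_ite_eq (0 : ℕ) (1 : ℂ)
    simp only [pow_zero]
    refine this.congr_fun fun b => ?_
    cases b <;> simp [Nat.multichoose_zero_succ]
  | succ a =>
    have := hasSum_choose_mul_geometric_of_norm_lt_one a hx
    rw [inv_pow, ← one_div]
    refine this.congr_fun fun b => ?_
    rw [Nat.multichoose_eq, show a + 1 + b - 1 = b + a by omega, Nat.choose_symm_add]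

/-- Coefficients of the double expansion of `exp (s x / (1 + x))`. -/
noncomputable def expCoeff (s : ℂ) (a b : ℕ) : ℂ := s ^ a / (a ! : ℂ) * ((-1) ^ b * (a.multichoose b : ℂ))

/-- Expand the exponential in powers of sx/(1+x), and each (1+x)^(-a) by the binomial series. The
norms form the same double series for ‖s‖ and -‖x‖ up to signs, which sums to exp(‖s‖‖x‖/(1-‖x‖));
hence the rearrangement is legitimate. -/
theorem expCoeff_hasSum {s x : ℂ} (hx : ‖x‖ < 1) :
    Summable (fun p : ℕ × ℕ => ‖expCoeff s p.1 p.2 * x ^ (p.1 + p.2)‖) ∧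
    HasSum (fun p : ℕ × ℕ => expCoeff s p.1 p.2 * x ^ (p.1 + p.2)) (Complex.exp (s * x / (1 + x))) := by
  have hxr : ‖(‖x‖ : ℂ)‖ < 1 := by simpa using hx
  have h1 : ∀ a, HasSum (fun b => ‖expCoeff s a b * x ^ (a + b)‖)
      (‖s‖ ^ a / (a ! : ℝ) * ‖x‖ ^ a * (1 - ‖x‖)⁻¹ ^ a) := fun a => by
    have h := (hasSum_multichoose_mul_pow hxr a).mul_left (((‖s‖ ^ a / (a ! : ℝ) * ‖x‖ ^ a : ℝ) : ℂ))
    rw [← Complex.hasSum_ofReal]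
    push_cast at h ⊢
    refine h.congr_fun fun b => ?_
    simp [expCoeff, pow_add]
    ring
  have h2 : ∀ a, HasSum (fun b => expCoeff s a b * x ^ (a + b)) ((s * x / (1 + x)) ^ a / (a ! : ℂ)) :=
      fun a => by
    have h := (hasSum_multichoose_mul_pow (x := -x) (by simpa using hx) a).mul_left
      (s ^ a / (a ! : ℂ) * x ^ a)
    have e : s ^ a / (a ! : ℂ) * x ^ a * (1 - -x)⁻¹ ^ a = (s * x / (1 + x)) ^ a / (a ! : ℂ) := by
      rw [sub_neg_eq_add, div_pow, mul_pow, inv_pow]; ring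
    rw [e] at h
    refine h.congr_fun fun b => ?_
    simp only [expCoeff, pow_add, neg_pow x b]
    ring
  have h3 : Summable (fun p : ℕ × ℕ => ‖expCoeff s p.1 p.2 * x ^ (p.1 + p.2)‖) := by
    rw [summable_prod_of_nonneg (fun _ => norm_nonneg _)]
    refine ⟨fun a => (h1 a).summable, ?_⟩
    simp only [fun a => (h1 a).tsum_eq]
    refine (Real.summable_pow_div_factorial (‖s‖ * ‖x‖ * (1 - ‖x‖)⁻¹)).congr fun a => ?_
    rw [mul_pow, mul_pow]; ring
  refine ⟨h3, ?_⟩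
  have h4 := h3.of_norm.hasSum
  have h5 := h4.prod_fiberwise h2
  have h6 := NormedSpace.expSeries_div_hasSum_exp (s * x / (1 + x))
  rw [← Complex.exp_eq_exp_ℂ] at h6
  rwa [h5.unique h6] at h4

theorem sum_antidiagonal_expCoeff_hasSum {s x : ℂ} (hx : ‖x‖ < 1) :
    Summable (fun n : ℕ => ‖(∑ p ∈ Finset.HasAntidiagonal.antidiagonal n, expCoeff s p.1 p.2) * x ^ n‖) ∧
    HasSum (fun n : ℕ => (∑ p ∈ Finset.HasAntidiagonal.antidiagonal n, expCoeff s p.1 p.2) * x ^ n)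
      (Complex.exp (s * x / (1 + x))) := by
  obtain ⟨h1, h2⟩ := expCoeff_hasSum (s := s) hx
  have e : ∀ n : ℕ, (∑ p ∈ Finset.HasAntidiagonal.antidiagonal n, expCoeff s p.1 p.2) * x ^ n =
      ∑ p ∈ Finset.HasAntidiagonal.antidiagonal n, expCoeff s p.1 p.2 * x ^ (p.1 + p.2) := fun n => by
    rw [Finset.sum_mul]
    refine Finset.sum_congr rfl fun p hp => ?_
    rw [Finset.HasAntidiagonal.mem_antidiagonal.1 hp]
  simp only [e]
  constructor
  · have h3 := (Finset.HasAntidiagonal.sigmaAntidiagonalEquivProd (A := ℕ)).summable_iff.2 h1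
    have h4 := h3.sigma' (fun n => (hasSum_fintype _).summable)
    refine h4.of_nonneg_of_le (fun _ => norm_nonneg _) fun n => ?_
    refine (norm_sum_le _ _).trans (le_of_eq ?_)
    rw [tsum_fintype, ← Finset.sum_coe_sort]
    rfl
  · have h3 := (Finset.HasAntidiagonal.sigmaAntidiagonalEquivProd (A := ℕ)).hasSum_iff.2 h2
    refine h3.sigma fun n => ?_
    rw [← Finset.sum_coe_sort]
    exact hasSum_fintype _

theorem one_add_pow_hasSum (l : ℕ) (w : ℂ) :
    Summable (fun c : ℕ => ‖(l.choose c : ℂ) * w ^ c‖) ∧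
    HasSum (fun c : ℕ => (l.choose c : ℂ) * w ^ c) ((1 + w) ^ l) := by
  have h0 : ∀ c ∉ Finset.range (l + 1), (l.choose c : ℂ) * w ^ c = 0 := fun c hc => by
    rw [Nat.choose_eq_zero_of_lt (by simpa using hc)]; simp
  refine ⟨summable_of_ne_finset_zero (s := Finset.range (l + 1)) fun c hc => by rw [h0 c hc, norm_zero],
    ?_⟩
  have := hasSum_sum_of_ne_finset_zero (L := .unconditional ℕ) h0
  convert! this using 1
  rw [add_comm, add_pow]
  exact Finset.sum_congr rfl fun c _ => by simp [mul_comm]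

/-- Coefficients of the power series of `(1 + w) ^ l * exp (2 s w / (1 + 2 w))`. -/
noncomputable def genCoeff (l : ℕ) (s : ℂ) (n : ℕ) : ℂ :=
  ∑ q ∈ Finset.HasAntidiagonal.antidiagonal n, (l.choose q.1 : ℂ) *
    ((∑ p ∈ Finset.HasAntidiagonal.antidiagonal q.2, expCoeff s p.1 p.2) * 2 ^ q.2)

theorem genCoeff_hasSum (l : ℕ) (s : ℂ) {w : ℂ} (hw : ‖2 * w‖ < 1) :
    Summable (fun n : ℕ => ‖genCoeff l s n * w ^ n‖) ∧
    HasSum (fun n : ℕ => genCoeff l s n * w ^ n)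
      ((1 + w) ^ l * Complex.exp (s * (2 * w) / (1 + 2 * w))) := by
  obtain ⟨h1, h2⟩ := one_add_pow_hasSum l w
  obtain ⟨h3, h4⟩ := sum_antidiagonal_expCoeff_hasSum (s := s) hw
  have e : ∀ n, genCoeff l s n * w ^ n = ∑ q ∈ Finset.HasAntidiagonal.antidiagonal n,
      ((l.choose q.1 : ℂ) * w ^ q.1) *
      ((∑ p ∈ Finset.HasAntidiagonal.antidiagonal q.2, expCoeff s p.1 p.2) * (2 * w) ^ q.2) := fun n => by
    rw [genCoeff, Finset.sum_mul]
    refine Finset.sum_congr rfl fun q hq => ?_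
    rw [← Finset.HasAntidiagonal.mem_antidiagonal.1 hq, pow_add, mul_pow]
    ring
  simp only [e]
  have h5 := summable_norm_sum_mul_antidiagonal_of_summable_norm h1 h3
  refine ⟨h5, ?_⟩
  have h6 := tsum_mul_tsum_eq_tsum_sum_antidiagonal_of_summable_norm h1 h3
  rw [h2.tsum_eq, h4.tsum_eq] at h6
  rw [h6]
  exact h5.of_norm.hasSum

theorem sum_antidiagonal_antidiagonal_reindex {M : Type*} [AddCommMonoid M] (n : ℕ)
    (f : ℕ → ℕ → ℕ → M) :
    ∑ q ∈ Finset.HasAntidiagonal.antidiagonal n, ∑ p ∈ Finset.HasAntidiagonal.antidiagonal q.2,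
      f p.1 p.2 q.1 =
    ∑ x ∈ Finset.HasAntidiagonal.antidiagonal n, ∑ y ∈ Finset.HasAntidiagonal.antidiagonal x.2,
      f x.1 y.1 y.2 := by
  rw [Finset.sum_sigma', Finset.sum_sigma']
  refine Finset.sum_nbij' (fun z => ⟨(z.2.1, z.2.2 + z.1.1), (z.2.2, z.1.1)⟩)
    (fun z => ⟨(z.2.2, z.1.1 + z.2.1), (z.1.1, z.2.1)⟩) ?_ ?_ ?_ ?_ ?_
  · rintro ⟨⟨a, b⟩, ⟨c, d⟩⟩ h
    simp only [Finset.mem_sigma, Finset.HasAntidiagonal.mem_antidiagonal] at h ⊢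
    exact ⟨by omega, trivial⟩
  · rintro ⟨⟨a, b⟩, ⟨c, d⟩⟩ h
    simp only [Finset.mem_sigma, Finset.HasAntidiagonal.mem_antidiagonal] at h ⊢
    exact ⟨by omega, trivial⟩
  · rintro ⟨⟨a, b⟩, ⟨c, d⟩⟩ h
    simp only [Finset.mem_sigma, Finset.HasAntidiagonal.mem_antidiagonal] at h ⊢
    rw [h.2]
  · rintro ⟨⟨a, b⟩, ⟨c, d⟩⟩ h
    simp only [Finset.mem_sigma, Finset.HasAntidiagonal.mem_antidiagonal] at h ⊢
    rw [h.2]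
  · rintro _ _
    rfl

/-- With ℓ = n+1, the indices a, b, c come from the exponential, the binomial series and (1+w)^ℓ.
For a ≥ 1 the product of `multichoose` = (a+b-1)!/((a-1)! b!) and `choose` = ℓ!/(c! (a+b+1)!) leaves
the factor 1/((a+b)(a+b+1)) of p_ℓ. -/
theorem genCoeff_eq_momentPoly (n : ℕ) (t : ℝ) :
    genCoeff (n + 1) (2 * ((n + 1 : ℕ) : ℂ) * t) n = (n + 1 : ℕ) * (momentPoly (n + 1) t : ℂ) := by
  set S := Finset.HasAntidiagonal.antidiagonal n with hS
  let f : ℕ → ℕ → ℕ → ℂ := fun a b c => ((n + 1).choose c : ℂ) *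
    (expCoeff (2 * ((n + 1 : ℕ) : ℂ) * t) a b * 2 ^ (a + b))
  have h1 : genCoeff (n + 1) (2 * ((n + 1 : ℕ) : ℂ) * t) n =
      ∑ x ∈ S, ∑ y ∈ Finset.HasAntidiagonal.antidiagonal x.2, f x.1 y.1 y.2 := by
    rw [← sum_antidiagonal_antidiagonal_reindex n f, genCoeff]
    refine Finset.sum_congr rfl fun q _ => ?_
    rw [Finset.sum_mul, Finset.mul_sum]
    refine Finset.sum_congr rfl fun p hp => ?_
    simp only [f, Finset.HasAntidiagonal.mem_antidiagonal.1 hp]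
  -- For a = 0 only b = 0, c = n contributes, with value ℓ. This is the leading 1 in p_ℓ.
  have h0 : ∑ x ∈ S with ¬ x.1 ≠ 0, ∑ y ∈ Finset.HasAntidiagonal.antidiagonal x.2, f x.1 y.1 y.2
      = (n + 1 : ℕ) := by
    have : (S.filter fun x => ¬ x.1 ≠ 0) = {(0, n)} := by
      ext ⟨a, m⟩
      simp only [hS, Finset.mem_filter, Finset.HasAntidiagonal.mem_antidiagonal, Finset.mem_singleton,
        Prod.mk.injEq, not_not]
      omega
    rw [this, Finset.sum_singleton, Finset.sum_eq_single (0, n)]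
    · simp [f, expCoeff]
    · rintro ⟨b, c⟩ hbc hne
      rw [Finset.HasAntidiagonal.mem_antidiagonal] at hbc
      cases b with
      | zero => exact absurd (by simpa using hbc) (by simpa using hne)
      | succ b => simp [f, expCoeff, Nat.multichoose_zero_succ]
    · simp
  rw [h1, ← Finset.sum_filter_add_sum_filter_not S (fun x => x.1 ≠ 0), h0, momentPoly, Nat.add_sub_cancel]
  push_cast
  rw [mul_add, mul_one, add_comm, add_right_inj, Finset.mul_sum, Finset.mul_sum]
  refine Finset.sum_congr rfl fun x hx => ?_
  rw [Finset.mul_sum, Finset.mul_sum]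
  refine Finset.sum_congr rfl fun y hy => ?_
  obtain ⟨a, m⟩ := x
  obtain ⟨b, c⟩ := y
  simp only [Finset.mem_filter, Finset.HasAntidiagonal.mem_antidiagonal] at hx hy
  obtain ⟨a, rfl⟩ : ∃ k, a = k + 1 := Nat.exists_eq_succ_of_ne_zero hx.2
  obtain rfl : m = b + c := hy.symm
  obtain rfl : n = a + 1 + (b + c) := hx.1.symm
  have e1 : (((a + 1).multichoose b : ℕ) : ℂ) = ((a + b)! : ℂ) / ((a ! : ℂ) * (b ! : ℂ)) := by
    rw [Nat.multichoose_eq, show a + 1 + b - 1 = a + b by omega, ← Nat.choose_symm_add,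
      Nat.cast_add_choose]
  have e2 : (((a + 1 + (b + c) + 1).choose c : ℕ) : ℂ) =
      ((a + 1 + (b + c) + 1)! : ℂ) / ((c ! : ℂ) * ((a + b + 2)! : ℂ)) := by
    rw [show a + 1 + (b + c) + 1 = c + (a + b + 2) by ring, Nat.cast_add_choose]
  simp only [f, expCoeff, e1, e2, Nat.add_sub_cancel]
  rw [Nat.factorial_succ (a + 1 + (b + c)), show a + b + 2 = (a + b + 1) + 1 from rfl,
    Nat.factorial_succ (a + b + 1), Nat.factorial_succ (a + b)]
  have f1 : ((a + b)! : ℂ) ≠ 0 := by exact_mod_cast Nat.factorial_ne_zero _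
  have f2 : (a ! : ℂ) ≠ 0 := by exact_mod_cast Nat.factorial_ne_zero _
  have f3 : (b ! : ℂ) ≠ 0 := by exact_mod_cast Nat.factorial_ne_zero _
  have f4 : (c ! : ℂ) ≠ 0 := by exact_mod_cast Nat.factorial_ne_zero _
  have f5 : ((a + 1)! : ℂ) ≠ 0 := by exact_mod_cast Nat.factorial_ne_zero _
  have f6 : (a : ℂ) + b + 1 ≠ 0 := by exact_mod_cast Nat.succ_ne_zero (a + b)
  have f7 : (a : ℂ) + 1 + b ≠ 0 := by rw [add_right_comm]; exact f6
  have f8 : (a : ℂ) + b + 1 + 1 ≠ 0 := by exact_mod_cast Nat.succ_ne_zero (a + b + 1)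
  have f9 : (a : ℂ) + 1 + b + 1 ≠ 0 := by rw [add_right_comm (a : ℂ)]; exact f8
  push_cast
  field_simp
  ring

/-! ### The map X and the contour integral for the moments -/

/-- The inverse `χ` of the `ψ`-transform in the coordinate `v = w / (1 + w)`. -/
noncomputable def diskMap (t : ℝ) (v : ℂ) : ℂ := v * Complex.exp (2 * t * (1 - v) / (1 + v))

theorem hasDerivAt_diskMap (t : ℝ) {v : ℂ} (hv : 1 + v ≠ 0) :
    HasDerivAt (diskMap t)
      (Complex.exp (2 * t * (1 - v) / (1 + v)) * (1 - 4 * t * v / (1 + v) ^ 2)) v := by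
  have h1 : HasDerivAt (fun v : ℂ => 2 * t * (1 - v) / (1 + v))
      ((2 * t * (-1) * (1 + v) - 2 * t * (1 - v) * 1) / (1 + v) ^ 2) v :=
    (((hasDerivAt_id v).const_sub 1).const_mul (2 * (t : ℂ))).div ((hasDerivAt_id v).const_add 1) hv
  refine ((hasDerivAt_id v).mul h1.cexp).congr_deriv ?_
  simp only [id]
  field_simp
  ring

theorem diskMap_ne_zero {t : ℝ} {v : ℂ} (hv : v ≠ 0) : diskMap t v ≠ 0 :=
  mul_ne_zero hv (Complex.exp_ne_zero _)

theorem one_add_ne_zero_of_norm_lt_one {v : ℂ} (hv : ‖v‖ < 1) : 1 + v ≠ 0 := fun h => by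
  rw [add_comm, add_eq_zero_iff_eq_neg] at h
  simp [h] at hv

theorem one_sub_ne_zero_of_norm_lt_one {v : ℂ} (hv : ‖v‖ < 1) : 1 - v ≠ 0 := fun h => by
  rw [sub_eq_zero] at h
  simp [← h] at hv

/-- The logarithmic derivative of X is 1/v - 4t/(1+v)^2, and the second term has a primitive on the
circle. So X winds once around 0. -/
theorem circleIntegral_diskMap_inv_mul_deriv (t : ℝ) {r : ℝ} (hr : 0 < r) (hr1 : r < 1) :
    ∮ v in C(0, r), diskMap t v ^ (-1 : ℤ) *
      (Complex.exp (2 * t * (1 - v) / (1 + v)) * (1 - 4 * t * v / (1 + v) ^ 2)) =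
    2 * Real.pi * Complex.I := by
  have h1 : ∀ v ∈ Metric.sphere (0 : ℂ) r, diskMap t v ^ (-1 : ℤ) *
      (Complex.exp (2 * t * (1 - v) / (1 + v)) * (1 - 4 * t * v / (1 + v) ^ 2)) =
      (v - 0)⁻¹ - 4 * t * (v - (-1)) ^ (-2 : ℤ) := fun v hv => by
    have hv' : ‖v‖ = r := by simpa using hv
    have h0 : v ≠ 0 := by rintro rfl; simp at hv'; linarith
    have h2 := one_add_ne_zero_of_norm_lt_one (hv'.trans_lt hr1)
    rw [diskMap, zpow_neg_one, zpow_neg, sub_neg_eq_add, add_comm v 1, sub_zero]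
    have := Complex.exp_ne_zero (2 * t * (1 - v) / (1 + v))
    field_simp
  rw [circleIntegral.integral_congr hr.le h1, circleIntegral.integral_sub,
    circleIntegral.integral_sub_center_inv _ hr.ne', circleIntegral.integral_const_mul,
    circleIntegral.integral_sub_zpow_of_ne (by norm_num), mul_zero, sub_zero]
  · rw [circleIntegrable_sub_inv_iff]
    right
    simpa [abs_of_pos hr] using hr.ne
  · refine ContinuousOn.circleIntegrable hr.le ?_
    refine ContinuousOn.mul continuousOn_const (ContinuousOn.zpow₀ (by fun_prop) _ fun v hv => Or.inl ?_)
    rw [sub_neg_eq_add, add_comm]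
    exact one_add_ne_zero_of_norm_lt_one (by simpa using (show ‖v‖ = r by simpa using hv).trans_lt hr1)

theorem hasDerivAt_div_one_sub {v : ℂ} (hv : 1 - v ≠ 0) :
    HasDerivAt (fun v : ℂ => v / (1 - v)) (1 / (1 - v) ^ 2) v := by
  refine ((hasDerivAt_id v).div ((hasDerivAt_id v).const_sub 1) hv).congr_deriv ?_
  simp only [id]
  field_simp
  ring

theorem circleIntegral_div_one_sub_inv_mul_deriv {r : ℝ} (hr : 0 < r) (hr1 : r < 1) :
    ∮ v in C(0, r), (v / (1 - v)) ^ (-1 : ℤ) * (1 / (1 - v) ^ 2) = 2 * Real.pi * Complex.I := by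
  have h1 : ∀ v ∈ Metric.sphere (0 : ℂ) r, (v / (1 - v)) ^ (-1 : ℤ) * (1 / (1 - v) ^ 2) =
      (v - 0)⁻¹ + (1 - v)⁻¹ := fun v hv => by
    have hv' : ‖v‖ = r := by simpa using hv
    have h0 : v ≠ 0 := by rintro rfl; simp at hv'; linarith
    have h2 := one_sub_ne_zero_of_norm_lt_one (hv'.trans_lt hr1)
    rw [zpow_neg_one, sub_zero]
    field_simp
    ring
  have h2 : ∀ v ∈ Metric.closedBall (0 : ℂ) r, DifferentiableAt ℂ (fun v : ℂ => (1 - v)⁻¹) v :=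
    fun v hv => DifferentiableAt.inv (by fun_prop) (one_sub_ne_zero_of_norm_lt_one
      (lt_of_le_of_lt (by simpa using hv) hr1))
  rw [circleIntegral.integral_congr hr.le h1, circleIntegral.integral_add,
    circleIntegral.integral_sub_center_inv _ hr.ne',
    Complex.circleIntegral_eq_zero_of_differentiable_on_off_countable hr.le Set.countable_empty
      (fun v hv => (h2 v hv).continuousAt.continuousWithinAt)
      (fun v hv => h2 v (Metric.ball_subset_closedBall hv.1)), add_zero]
  · rw [circleIntegrable_sub_inv_iff]
    right
    simpa [abs_of_pos hr] using hr.ne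
  · exact ContinuousOn.circleIntegrable hr.le fun v hv =>
      (h2 v (Metric.sphere_subset_closedBall hv)).continuousAt.continuousWithinAt

/-- The Fourier coefficients in the statement: `e^{-2ℓt} p_ℓ(t)`. -/
noncomputable def moment (t : ℝ) (l : ℕ) : ℝ := Real.exp (-2 * (l : ℝ) * t) * momentPoly l t

/-- Contour integral of `χ^{-ℓ} dw`, in the coordinate `v = w / (1 + w)`. -/
noncomputable def contour (t : ℝ) (l : ℕ) (c : ℂ) (r : ℝ) : ℂ :=
  ∮ v in C(c, r), (diskMap t v ^ l)⁻¹ * (1 / (1 - v) ^ 2)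

/-- Since (1-v)/(1+v) = 1 - 2w/(1+2w), the form X^(-ℓ) dw equals e^(-2ℓt) w^(-ℓ) (1+w)^ℓ
exp(2ℓt·2w/(1+2w)) dw, whose residue is a `genCoeff`. The radius 1/8 forces |w| ≤ 1/7, inside the
region |2w| < 1 of convergence. -/
theorem contour_eq_moment (t : ℝ) (n : ℕ) :
    contour t (n + 1) 0 (1 / 8) =
      2 * Real.pi * Complex.I * ((n + 1 : ℕ) * (moment t (n + 1) : ℂ)) := by
  have hlt : ∀ v ∈ Metric.sphere (0 : ℂ) (1 / 8), ‖v‖ = 1 / 8 := fun v hv => by simpa using hv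
  have hv0 : ∀ v ∈ Metric.sphere (0 : ℂ) (1 / 8), v ≠ 0 := fun v hv => by
    have := hlt v hv
    rintro rfl; norm_num at this
  have hv1 : ∀ v ∈ Metric.sphere (0 : ℂ) (1 / 8), 1 - v ≠ 0 := fun v hv =>
    one_sub_ne_zero_of_norm_lt_one (by rw [hlt v hv]; norm_num)
  have hv2 : ∀ v ∈ Metric.sphere (0 : ℂ) (1 / 8), 1 + v ≠ 0 := fun v hv =>
    one_add_ne_zero_of_norm_lt_one (by rw [hlt v hv]; norm_num)
  have hR : ∀ v ∈ Metric.sphere (0 : ℂ) (1 / 8), ‖v / (1 - v)‖ ≤ 1 / 7 := fun v hv => by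
    have h1 : (7 / 8 : ℝ) ≤ ‖1 - v‖ := by
      have := norm_sub_norm_le 1 v
      rw [hlt v hv, norm_one] at this
      linarith
    rw [norm_div, hlt v hv, div_le_iff₀ (by linarith)]
    linarith
  set s : ℂ := 2 * ((n + 1 : ℕ) : ℂ) * t with hs
  have hsum : Summable fun k => ‖genCoeff (n + 1) s k‖ * (1 / 7 : ℝ) ^ k := by
    have := (genCoeff_hasSum (n + 1) s (w := (1 / 7 : ℝ)) (by norm_num)).1
    refine this.congr fun k => ?_
    rw [norm_mul, norm_pow, Complex.norm_real]
    norm_num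
  have h := circleIntegral_eq_coeff (by norm_num) (fun v hv => hasDerivAt_div_one_sub (hv1 v hv))
    (ContinuousOn.div continuousOn_const (by fun_prop) fun v hv => pow_ne_zero 2 (hv1 v hv))
    (fun v hv => div_ne_zero (hv0 v hv) (hv1 v hv))
    (circleIntegral_div_one_sub_inv_mul_deriv (by norm_num) (by norm_num)) hR hsum
    (fun v hv => (genCoeff_hasSum (n + 1) s (w := v / (1 - v)) (by
      have := hR v hv
      rw [norm_mul, show ‖(2 : ℂ)‖ = 2 by simp]
      linarith)).2) n
  rw [genCoeff_eq_momentPoly] at h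
  have e : ∀ v ∈ Metric.sphere (0 : ℂ) (1 / 8), (diskMap t v ^ (n + 1))⁻¹ * (1 / (1 - v) ^ 2) =
      Complex.exp (-2 * ((n + 1 : ℕ) : ℂ) * t) * ((1 + v / (1 - v)) ^ (n + 1) *
        Complex.exp (s * (2 * (v / (1 - v))) / (1 + 2 * (v / (1 - v)))) *
        ((v / (1 - v)) ^ (-(n : ℤ) - 1) * (1 / (1 - v) ^ 2))) := fun v hv => by
    have h0 := hv0 v hv
    have h1 := hv1 v hv
    have h2 := hv2 v hv
    have e1 : 1 + v / (1 - v) = (1 - v)⁻¹ := by field_simp; ring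
    have e2 : s * (2 * (v / (1 - v))) / (1 + 2 * (v / (1 - v))) = s * (2 * v) / (1 + v) := by
      rw [show 1 + 2 * (v / (1 - v)) = (1 + v) / (1 - v) by field_simp; ring]
      field_simp
    have e3 : (Complex.exp (2 * t * (1 - v) / (1 + v)) ^ (n + 1))⁻¹ =
        Complex.exp (-2 * ((n + 1 : ℕ) : ℂ) * t) * Complex.exp (s * (2 * v) / (1 + v)) := by
      rw [← Complex.exp_nat_mul, ← Complex.exp_neg, ← Complex.exp_add, hs]
      congr 1
      field_simp
      ring
    rw [diskMap, mul_pow, mul_inv, e3, e1, e2, show -(n : ℤ) - 1 = -((n + 1 : ℕ) : ℤ) by push_cast; ring,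
      zpow_neg, zpow_natCast,
      div_pow v, inv_pow]
    field_simp
  rw [contour, circleIntegral.integral_congr (by norm_num) e, circleIntegral.integral_const_mul, h, moment]
  push_cast
  ring_nf

/-! ### Changing the contour -/

/-- The two circles need not be concentric. Induction on n: v^(-n-1) h(v) = v^(-n) `dslope h 0 v` +
h(0) v^(-n-1), where the last term integrates to the same value over any circle around 0. The case n
= 0 is Cauchy's theorem. -/
theorem circleIntegral_div_pow_eq {U : Set ℂ} (hU : IsOpen U) {c c' : ℂ} {R R' : ℝ}
    (hc : Metric.closedBall c R ⊆ U) (hc' : Metric.closedBall c' R' ⊆ U)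
    (h0 : (0 : ℂ) ∈ Metric.ball c R) (h0' : (0 : ℂ) ∈ Metric.ball c' R') (n : ℕ) :
    ∀ h : ℂ → ℂ, DifferentiableOn ℂ h U →
      ∮ v in C(c, R), (v ^ n)⁻¹ * h v = ∮ v in C(c', R'), (v ^ n)⁻¹ * h v := by
  have hcauchy : ∀ (c : ℂ) (R : ℝ), Metric.closedBall c R ⊆ U → (0 : ℂ) ∈ Metric.ball c R →
      ∀ h : ℂ → ℂ, DifferentiableOn ℂ h U → ∮ v in C(c, R), h v = 0 := fun c R hc h0 h hh =>
    Complex.circleIntegral_eq_zero_of_differentiable_on_off_countable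
      (Metric.pos_of_mem_ball h0).le Set.countable_empty (hh.continuousOn.mono hc)
      (fun v hv => hh.differentiableAt (hU.mem_nhds (hc (Metric.ball_subset_closedBall hv.1))))
  induction n with
  | zero =>
    intro h hh
    simp only [pow_zero, inv_one, one_mul]
    rw [hcauchy c R hc h0 h hh, hcauchy c' R' hc' h0' h hh]
  | succ n ih =>
    intro h hh
    have h0U : (0 : ℂ) ∈ U := hc (Metric.ball_subset_closedBall h0)
    have hd : DifferentiableOn ℂ (dslope h 0) U :=
      (Complex.differentiableOn_dslope (hU.mem_nhds h0U)).2 hh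
    have key : ∀ (c : ℂ) (R : ℝ), Metric.closedBall c R ⊆ U → (0 : ℂ) ∈ Metric.ball c R →
        ∮ v in C(c, R), (v ^ (n + 1))⁻¹ * h v = (∮ v in C(c, R), (v ^ n)⁻¹ * dslope h 0 v) +
          h 0 * if n = 0 then 2 * Real.pi * Complex.I else 0 := fun c R hc h0 => by
      have hRpos : 0 < R := Metric.pos_of_mem_ball h0
      have hne : ∀ v ∈ Metric.sphere c R, v ≠ 0 := by
        rintro v hv rfl
        rw [Metric.mem_sphere] at hv
        rw [Metric.mem_ball] at h0
        linarith
      have e : ∀ v ∈ Metric.sphere c R, (v ^ (n + 1))⁻¹ * h v =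
          (v ^ n)⁻¹ * dslope h 0 v + h 0 * (v - 0) ^ (-((n + 1 : ℕ) : ℤ)) := fun v hv => by
        have hv0 := hne v hv
        rw [dslope_of_ne _ hv0, slope_def_field, zpow_neg, zpow_natCast, sub_zero]
        field_simp
        ring
      rw [circleIntegral.integral_congr hRpos.le e, circleIntegral.integral_add,
        circleIntegral.integral_const_mul]
      · congr 2
        split_ifs with hn
        · subst hn
          simpa using circleIntegral.integral_sub_inv_of_mem_ball h0
        · exact circleIntegral.integral_sub_zpow_of_ne (by omega) _ _ _
      · refine ContinuousOn.circleIntegrable hRpos.le (ContinuousOn.mul ?_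
          ((hd.continuousOn.mono hc).mono Metric.sphere_subset_closedBall))
        exact ContinuousOn.inv₀ (by fun_prop) fun v hv => pow_ne_zero _ (hne v hv)
      · refine ContinuousOn.circleIntegrable hRpos.le (continuousOn_const.mul ?_)
        exact ContinuousOn.zpow₀ (by fun_prop) _ fun v hv => Or.inl (by simpa using hne v hv)
    rw [key c R hc h0, key c' R' hc' h0', ih _ hd]

theorem inv_diskMap_pow (t : ℝ) (l : ℕ) (v : ℂ) :
    (diskMap t v ^ l)⁻¹ = (v ^ l)⁻¹ * Complex.exp (-(l * (2 * t * (1 - v) / (1 + v)))) := by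
  rw [diskMap, mul_pow, mul_inv, ← Complex.exp_nat_mul, ← Complex.exp_neg]

theorem contour_eq_of_lt_one (t : ℝ) (l : ℕ) {r r' : ℝ} (hr : 0 < r) (hr1 : r < 1) (hr' : 0 < r')
    (hr1' : r' < 1) : contour t l 0 r = contour t l 0 r' := by
  simp only [contour, inv_diskMap_pow, mul_assoc]
  refine circleIntegral_div_pow_eq (U := Metric.ball 0 1) Metric.isOpen_ball
    (Metric.closedBall_subset_ball hr1) (Metric.closedBall_subset_ball hr1')
    (Metric.mem_ball_self hr) (Metric.mem_ball_self hr') l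
    (fun v => Complex.exp (-(l * (2 * (t * (1 - v)) / (1 + v)))) * (1 / (1 - v) ^ 2)) ?_
  intro v hv
  have hv' : ‖v‖ < 1 := by simpa using hv
  have h1 := one_add_ne_zero_of_norm_lt_one hv'
  have h2 := pow_ne_zero 2 (one_sub_ne_zero_of_norm_lt_one hv')
  refine DifferentiableAt.differentiableWithinAt ?_
  fun_prop (disch := assumption)

theorem contour_eq_moment_of_lt_one (t : ℝ) (n : ℕ) {r : ℝ} (hr : 0 < r) (hr1 : r < 1) :
    contour t (n + 1) 0 r = 2 * Real.pi * Complex.I * ((n + 1 : ℕ) * (moment t (n + 1) : ℂ)) := by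
  rw [contour_eq_of_lt_one t (n + 1) hr hr1 (by norm_num : (0 : ℝ) < 1 / 8) (by norm_num),
    contour_eq_moment]

/-! ### Moments of the free unitary Poisson distribution by Lagrange inversion -/

theorem integrable_circle_of_continuous {E : Type*} [NormedAddCommGroup E] (μ : Measure Circle)
    [IsFiniteMeasure μ] {g : Circle → E} (hg : Continuous g) : Integrable g μ :=
  hg.integrable_of_hasCompactSupport (HasCompactSupport.of_compactSpace g)

theorem psiTransform_hasSum (μ : Measure Circle) [IsProbabilityMeasure μ] {z : ℂ} (hz : ‖z‖ < 1) :
    HasSum (fun k : ℕ => (if k = 0 then 0 else ∫ u : Circle, (u : ℂ) ^ k ∂μ) * z ^ k)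
      (psiTransform μ z) := by
  have h := hasSum_integral_of_summable_integral_norm (μ := μ)
    (F := fun (k : ℕ) (u : Circle) => if k = 0 then 0 else ((u : ℂ) * z) ^ k) (fun k => ?_) ?_
  · have e1 : ∫ u : Circle, (∑' k : ℕ, if k = 0 then 0 else ((u : ℂ) * z) ^ k) ∂μ = psiTransform μ z := by
      refine integral_congr_ae (Eventually.of_forall fun u => ?_)
      dsimp only
      have hu : ‖(u : ℂ) * z‖ < 1 := by simpa [Circle.norm_coe] using hz
      have h1 := (hasSum_geometric_of_norm_lt_one hu).sub (hasSum_ite_eq (0 : ℕ) (1 : ℂ))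
      have h2 : HasSum (fun k : ℕ => if k = 0 then 0 else ((u : ℂ) * z) ^ k)
          ((1 - (u : ℂ) * z)⁻¹ - 1) := by
        refine h1.congr_fun fun k => ?_
        split_ifs with hk <;> simp [hk]
      rw [h2.tsum_eq]
      have := one_sub_ne_zero_of_norm_lt_one hu
      field_simp
      ring
    rw [e1] at h
    refine h.congr_fun fun k => ?_
    split_ifs with hk
    · simp
    · rw [← integral_mul_const]
      simp only [mul_pow]
  · refine integrable_circle_of_continuous μ ?_
    split_ifs
    · exact continuous_const
    · fun_prop
  · refine (summable_geometric_of_norm_lt_one (x := ‖z‖) (by simpa using hz)).of_nonneg_of_le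
      (fun k => integral_nonneg fun _ => norm_nonneg _) fun k => ?_
    calc ∫ u : Circle, ‖if k = 0 then 0 else ((u : ℂ) * z) ^ k‖ ∂μ ≤ ∫ u : Circle, ‖z‖ ^ k ∂μ := by
          refine integral_mono_of_nonneg (Eventually.of_forall fun _ => norm_nonneg _)
            (integrable_const _) (Eventually.of_forall fun u => ?_)
          dsimp only
          split_ifs
          · simp
          · simp [mul_pow, Circle.norm_coe]
      _ = ‖z‖ ^ k := by simp

/-- Under w = v/(1-v) one has w + 1/2 = (1+v)/(2(1-v)) and 1 + w = 1/(1-v), so the prescribed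
S-transform says χ(w) = X(v). The point v = 0 is left out because S is prescribed only for w ≠ 0. -/
theorem IsFreeUnitaryPoisson.psiTransform_diskMap {t : ℝ} {μ : Measure Circle}
    (hμ : IsFreeUnitaryPoisson t μ) :
    ∀ᶠ v in 𝓝[≠] (0 : ℂ), psiTransform μ (diskMap t v) = v / (1 - v) := by
  obtain ⟨χ, -, -, -, h1, h2⟩ := hμ.hasSTransform
  have hc : ContinuousAt (fun v : ℂ => v / (1 - v)) 0 :=
    ContinuousAt.div (by fun_prop) (by fun_prop) (by simp)
  have ht : Tendsto (fun v : ℂ => v / (1 - v)) (𝓝[≠] 0) (𝓝[≠] 0) := by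
    refine tendsto_nhdsWithin_of_tendsto_nhds_of_eventually_within _ ?_ ?_
    · have := hc.tendsto
      simp only [zero_div] at this
      exact this.mono_left nhdsWithin_le_nhds
    · have h3 : ∀ᶠ v in 𝓝[≠] (0 : ℂ), v ∈ Metric.ball (0 : ℂ) 1 :=
        nhdsWithin_le_nhds (Metric.ball_mem_nhds _ one_pos)
      filter_upwards [h3, self_mem_nhdsWithin] with v hv hv0
      exact div_ne_zero hv0 (one_sub_ne_zero_of_norm_lt_one (by simpa using hv))
  have h3 : ∀ᶠ v in 𝓝[≠] (0 : ℂ), v ∈ Metric.ball (0 : ℂ) 1 :=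
    nhdsWithin_le_nhds (Metric.ball_mem_nhds _ one_pos)
  filter_upwards [ht.eventually h2, (ht.mono_right nhdsWithin_le_nhds).eventually h1, h3,
    self_mem_nhdsWithin] with v e1 e2 hv hv0
  have hv0' : v ≠ 0 := hv0
  have hvn : ‖v‖ < 1 := by simpa using hv
  have hs := one_sub_ne_zero_of_norm_lt_one hvn
  have ha := one_add_ne_zero_of_norm_lt_one hvn
  have e3 : χ (v / (1 - v)) = diskMap t v := by
    have e4 : (t : ℂ) / (v / (1 - v) + 1 / 2) = 2 * t * (1 - v) / (1 + v) := by
      rw [show v / (1 - v) + 1 / 2 = (1 + v) / (2 * (1 - v)) by field_simp; ring]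
      field_simp
    rw [e4] at e1
    rw [diskMap, e1, show 1 + v / (1 - v) = 1 / (1 - v) by field_simp; ring]
    field_simp
  rw [← e3, e2]

/-- The moment is a coefficient of ψ, hence the integral of ψ(X) X^(-ℓ-1) dX; with ψ(X) = w,
integration by parts turns this into the integral of X^(-ℓ) dw divided by ℓ, which is `contour`. -/
theorem IsFreeUnitaryPoisson.integral_pow {t : ℝ} {μ : Measure Circle}
    (hμ : IsFreeUnitaryPoisson t μ) (n : ℕ) :
    ∫ u : Circle, (u : ℂ) ^ (n + 1) ∂μ = (moment t (n + 1) : ℂ) := by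
  have := hμ.isProbabilityMeasure
  have hc : ContinuousAt (diskMap t) 0 :=
    (hasDerivAt_diskMap t (by simp)).continuousAt
  have h1 : ∀ᶠ v in 𝓝[≠] (0 : ℂ), ‖diskMap t v‖ < 1 / 2 := by
    have h2 := hc.norm.tendsto
    simp only [diskMap, zero_mul, norm_zero] at h2
    exact nhdsWithin_le_nhds (h2.eventually_lt_const (by norm_num))
  obtain ⟨ε, hε, hball⟩ := Metric.eventually_nhds_iff.1
    (eventually_nhdsWithin_iff.1 (hμ.psiTransform_diskMap.and h1))
  -- Small enough for the functional equation and for |X| < 1/2. The coefficients of ψ have norm at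
  -- most 1, so its series is dominated by a geometric one.
  set r := min (ε / 2) (1 / 2) with hr
  have hr0 : 0 < r := by positivity
  have hr1 : r < 1 := lt_of_le_of_lt (min_le_right _ _) (by norm_num)
  have hrε : r < ε := lt_of_le_of_lt (min_le_left _ _) (by linarith)
  have hn : ∀ v ∈ Metric.sphere (0 : ℂ) r, ‖v‖ = r := fun v hv => by simpa using hv
  have hv0 : ∀ v ∈ Metric.sphere (0 : ℂ) r, v ≠ 0 := fun v hv => by
    have := hn v hv
    rintro rfl
    simp at this; linarith
  have hP : ∀ v ∈ Metric.sphere (0 : ℂ) r,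
      psiTransform μ (diskMap t v) = v / (1 - v) ∧ ‖diskMap t v‖ < 1 / 2 := fun v hv =>
    hball (by rw [dist_zero_right, hn v hv]; exact hrε) (hv0 v hv)
  have ha : ∀ v ∈ Metric.sphere (0 : ℂ) r, 1 + v ≠ 0 := fun v hv =>
    one_add_ne_zero_of_norm_lt_one ((hn v hv).trans_lt hr1)
  have hs : ∀ v ∈ Metric.sphere (0 : ℂ) r, 1 - v ≠ 0 := fun v hv =>
    one_sub_ne_zero_of_norm_lt_one ((hn v hv).trans_lt hr1)
  set X' : ℂ → ℂ := fun v => Complex.exp (2 * t * (1 - v) / (1 + v)) * (1 - 4 * t * v / (1 + v) ^ 2)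
    with hX'
  have hX'c : ContinuousOn X' (Metric.sphere 0 r) := by
    intro v hv
    have h1 := ha v hv
    have h2 := pow_ne_zero 2 h1
    refine ContinuousAt.continuousWithinAt ?_
    simp only [hX']
    fun_prop (disch := assumption)
  have hXd : ∀ v ∈ Metric.sphere (0 : ℂ) r, HasDerivAt (diskMap t) (X' v) v := fun v hv =>
    hasDerivAt_diskMap t (ha v hv)
  have hX0 : ∀ v ∈ Metric.sphere (0 : ℂ) r, diskMap t v ≠ 0 := fun v hv => diskMap_ne_zero (hv0 v hv)
  have hXc : ContinuousOn (diskMap t) (Metric.sphere 0 r) := fun v hv =>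
    (hXd v hv).continuousAt.continuousWithinAt
  have key := circleIntegral_eq_coeff
    (C := fun k : ℕ => if k = 0 then 0 else ∫ u : Circle, (u : ℂ) ^ k ∂μ) hr0.le hXd hX'c hX0
    (circleIntegral_diskMap_inv_mul_deriv t hr0 hr1) (fun v hv => (hP v hv).2.le) ?_
    (fun v hv => psiTransform_hasSum μ ((hP v hv).2.trans (by norm_num))) (n + 1)
  · simp only [Nat.add_eq_zero_iff, one_ne_zero, and_false, if_false] at key
    rw [circleIntegral.integral_congr hr0.le
      (g := fun v => v / (1 - v) * (diskMap t v ^ (-((n + 1 : ℕ) : ℤ) - 1) * X' v))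
      (fun v hv => by dsimp only; rw [(hP v hv).1])] at key
    -- The integrand is the derivative of w X^(-ℓ).
    have hparts : ∮ v in C(0, r), ((diskMap t v ^ (n + 1))⁻¹ * (1 / (1 - v) ^ 2) -
        ((n + 1 : ℕ) : ℂ) * (v / (1 - v) * (diskMap t v ^ (-((n + 1 : ℕ) : ℤ) - 1) * X' v))) = 0 := by
      refine circleIntegral.integral_eq_zero_of_hasDerivWithinAt
        (f := fun v => v / (1 - v) * diskMap t v ^ (-((n + 1 : ℕ) : ℤ))) hr0.le fun v hv => ?_
      have d1 := hasDerivAt_div_one_sub (hs v hv)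
      have d2 := (hasDerivAt_zpow (-((n + 1 : ℕ) : ℤ)) (diskMap t v) (Or.inl (hX0 v hv))).comp v (hXd v hv)
      refine ((d1.mul d2).congr_deriv ?_).hasDerivWithinAt
      simp only [Function.comp_apply, zpow_neg, zpow_natCast]
      push_cast
      ring
    rw [circleIntegral.integral_sub, circleIntegral.integral_const_mul, key, sub_eq_zero] at hparts
    · have h4 : contour t (n + 1) 0 r = _ := hparts
      rw [contour_eq_moment_of_lt_one t n hr0 hr1] at h4
      have hpi : (2 * Real.pi * Complex.I : ℂ) ≠ 0 := Complex.two_pi_I_ne_zero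
      have hn1 : ((n + 1 : ℕ) : ℂ) ≠ 0 := by exact_mod_cast Nat.succ_ne_zero n
      have h5 : (2 * Real.pi * Complex.I : ℂ) * ((n + 1 : ℕ) : ℂ) ≠ 0 := mul_ne_zero hpi hn1
      apply mul_left_cancel₀ h5
      linear_combination -h4
    · refine ContinuousOn.circleIntegrable hr0.le (ContinuousOn.mul ?_ ?_)
      · exact (hXc.pow _).inv₀ fun v hv => pow_ne_zero _ (hX0 v hv)
      · exact ContinuousOn.div (by fun_prop) (by fun_prop) fun v hv => pow_ne_zero 2 (hs v hv)
    · refine ContinuousOn.circleIntegrable hr0.le (continuousOn_const.mul (ContinuousOn.mul ?_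
        (ContinuousOn.mul ?_ hX'c)))
      · exact ContinuousOn.div (by fun_prop) (by fun_prop) fun v hv => hs v hv
      · exact hXc.zpow₀ _ fun v hv => Or.inl (hX0 v hv)
  · refine (summable_geometric_two).of_nonneg_of_le (fun k => by positivity) fun k => ?_
    refine mul_le_of_le_one_left (by positivity) ?_
    split_ifs
    · simp
    · refine (norm_integral_le_of_norm_le_const (C := 1) (Eventually.of_forall fun u => ?_)).trans ?_
      · simp [Circle.norm_coe]
      · simp

/-! ### Geometric decay of the moments for t > 1 -/

/-- The real part of (1-v)/(1+v) is (1-|v|^2)/|1+v|^2. -/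
theorem norm_diskMap (t : ℝ) (v : ℂ) :
    ‖diskMap t v‖ = ‖v‖ * Real.exp (2 * t * ((1 - ‖v‖ ^ 2) / ‖1 + v‖ ^ 2)) := by
  rw [diskMap, norm_mul, Complex.norm_exp]
  congr 2
  rw [mul_div_assoc, show (2 : ℂ) * t = ((2 * t : ℝ) : ℂ) by push_cast; ring, Complex.re_ofReal_mul,
    Complex.div_re, ← Complex.normSq_eq_norm_sq, ← Complex.normSq_eq_norm_sq, ← add_div]
  congr 2
  simp [Complex.normSq_apply]
  ring

/-- The period is shifted to [-π, π] and the bound enlarged to the whole line, so that complete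
Gaussian integrals can be used. -/
theorem norm_circleIntegral_le_of_le_integrable {f : ℂ → ℂ} {c : ℂ} {r : ℝ} (hr : 0 ≤ r) {g : ℝ → ℝ}
    (hg : Integrable g) (hg0 : 0 ≤ g)
    (hfg : ∀ θ ∈ Set.Icc (-Real.pi) Real.pi, ‖f (circleMap c r θ)‖ ≤ g θ) :
    ‖∮ v in C(c, r), f v‖ ≤ r * ∫ θ, g θ := by
  have hper : Function.Periodic (fun θ : ℝ => deriv (circleMap c r) θ • f (circleMap c r θ)) (2 * Real.pi) := by
    intro θ
    dsimp only
    rw [deriv_circleMap, deriv_circleMap, periodic_circleMap 0 r θ, periodic_circleMap c r θ]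
  have h1 := hper.intervalIntegral_add_eq 0 (-Real.pi)
  rw [circleIntegral]
  rw [zero_add, show -Real.pi + 2 * Real.pi = Real.pi by ring] at h1
  rw [h1, ← integral_const_mul]
  have hpi : -Real.pi ≤ Real.pi := by linarith [Real.pi_pos]
  refine (intervalIntegral.norm_integral_le_of_norm_le (g := fun θ => r * g θ) hpi
    (Eventually.of_forall fun θ hθ => ?_) (hg.const_mul r).intervalIntegrable).trans ?_
  · rw [norm_smul, show ‖deriv (circleMap c r) θ‖ = r by simp [deriv_circleMap, abs_of_nonneg hr]]
    exact mul_le_mul_of_nonneg_left (hfg θ ⟨hθ.1.le, hθ.2⟩) hr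
  · rw [intervalIntegral.integral_of_le hpi]
    exact setIntegral_le_integral (hg.const_mul r) (Eventually.of_forall fun θ => mul_nonneg hr (hg0 θ))

theorem norm_moment_eq (t : ℝ) (n : ℕ) {r : ℝ} (hr : 0 < r) (hr1 : r < 1) :
    2 * Real.pi * ((n : ℝ) + 1) * |moment t (n + 1)| = ‖contour t (n + 1) 0 r‖ := by
  rw [contour_eq_moment_of_lt_one t n hr hr1]
  simp only [norm_mul, Complex.norm_natCast, Complex.norm_real, Complex.norm_I, Real.norm_eq_abs,
    abs_of_pos Real.pi_pos, RCLike.norm_ofNat]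
  push_cast
  ring

theorem summable_moment_of_one_lt {t : ℝ} (ht : 1 < t) : Summable fun n => |moment t (n + 1)| := by
  -- The midpoint of 1/t and 1. On this circle |X| is at least r exp(2t(1-r)/(1+r)) ≥ exp(1-1/r)
  -- exp(t(1-r)) = exp((1-r)(t-1/r)), which is 1/q.
  set r : ℝ := (1 + 1 / t) / 2 with hr
  have ht0 : 0 < t := by linarith
  have h1 : 1 / t < 1 := by rw [div_lt_one ht0]; exact ht
  have h1' : 0 < 1 / t := by positivity
  have hr0 : 0 < r := by positivity
  have hr1 : r < 1 := by rw [hr]; linarith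
  have hrt : 1 / r < t := by rw [div_lt_comm₀ hr0 ht0, hr]; linarith
  set q : ℝ := Real.exp (-((1 - r) * (t - 1 / r))) with hq
  have hq1 : q < 1 := by
    rw [hq, Real.exp_lt_one_iff, neg_lt_zero]
    exact mul_pos (by linarith) (by linarith)
  have hX : ∀ v ∈ Metric.sphere (0 : ℂ) r, ‖diskMap t v‖⁻¹ ≤ q := fun v hv => by
    have hv' : ‖v‖ = r := by simpa using hv
    have ha : 0 < ‖1 + v‖ := norm_pos_iff.2 (one_add_ne_zero_of_norm_lt_one (hv'.trans_lt hr1))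
    have ha' : ‖1 + v‖ ≤ 1 + r := (norm_add_le _ _).trans (by rw [norm_one, hv'])
    have h2 : 2 * t * ((1 - r) / (1 + r)) ≤ 2 * t * ((1 - r ^ 2) / ‖1 + v‖ ^ 2) := by
      have : (1 - r) / (1 + r) = (1 - r ^ 2) / (1 + r) ^ 2 := by field_simp; ring
      rw [this]
      have : 0 ≤ 1 - r ^ 2 := by nlinarith
      gcongr
    have h3 : t * (1 - r) ≤ 2 * t * ((1 - r) / (1 + r)) := by
      rw [show 2 * t * ((1 - r) / (1 + r)) = t * (1 - r) * (2 / (1 + r)) by ring]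
      refine le_mul_of_one_le_right (mul_nonneg ht0.le (by linarith)) ?_
      rw [one_le_div (by linarith)]
      linarith
    have h4 : Real.exp (1 - 1 / r) ≤ r := by
      rw [← Real.le_log_iff_exp_le hr0]
      have := Real.one_sub_inv_le_log_of_pos hr0
      rwa [inv_eq_one_div] at this
    rw [hq, Real.exp_neg, norm_diskMap, hv']
    refine inv_anti₀ (Real.exp_pos _) ?_
    calc Real.exp ((1 - r) * (t - 1 / r)) = Real.exp (1 - 1 / r) * Real.exp (t * (1 - r)) := by
          rw [← Real.exp_add]; congr 1; field_simp; ring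
      _ ≤ _ := mul_le_mul h4 (Real.exp_le_exp.2 (h3.trans h2)) (Real.exp_pos _).le hr0.le
  have hq0 : 0 < q := Real.exp_pos _
  have hbound : ∀ n : ℕ, |moment t (n + 1)| ≤ q ^ n * (1 / (1 - r) ^ 2) := fun n => by
    have h5 : ‖contour t (n + 1) 0 r‖ ≤ 2 * Real.pi * r * (q ^ (n + 1) * (1 / (1 - r) ^ 2)) := by
      refine circleIntegral.norm_integral_le_of_norm_le_const hr0.le fun v hv => ?_
      have hv' : ‖v‖ = r := by simpa using hv
      have h6 : 1 - r ≤ ‖1 - v‖ := by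
        have := norm_sub_norm_le 1 v
        rwa [norm_one, hv'] at this
      have h7 : 0 < 1 - r := by linarith
      rw [norm_mul, norm_inv, norm_pow, ← inv_pow, norm_div, norm_one, norm_pow]
      gcongr
      exact hX v hv
    rw [← norm_moment_eq t n hr0 hr1] at h5
    have hn : (1 : ℝ) ≤ n + 1 := by linarith [n.cast_nonneg (α := ℝ)]
    have hp := Real.pi_pos
    have h8 : q ^ (n + 1) * (1 / (1 - r) ^ 2) ≤ q ^ n * (1 / (1 - r) ^ 2) := by
      gcongr ?_ * _
      exact pow_le_pow_of_le_one hq0.le hq1.le (Nat.le_succ n)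
    have h9 : 0 ≤ q ^ (n + 1) * (1 / (1 - r) ^ 2) := by positivity
    have h10 : 2 * Real.pi * |moment t (n + 1)| ≤ 2 * Real.pi * (q ^ n * (1 / (1 - r) ^ 2)) := by
      calc 2 * Real.pi * |moment t (n + 1)| = 2 * Real.pi * 1 * |moment t (n + 1)| := by ring
        _ ≤ 2 * Real.pi * ((n : ℝ) + 1) * |moment t (n + 1)| := by gcongr
        _ ≤ _ := h5
        _ ≤ 2 * Real.pi * 1 * (q ^ n * (1 / (1 - r) ^ 2)) := by gcongr
        _ = _ := by ring
    exact le_of_mul_le_mul_left h10 (by positivity)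
  exact ((summable_geometric_of_lt_one hq0.le hq1).mul_right _).of_nonneg_of_le
    (fun _ => abs_nonneg _) hbound

/-! ### Decay for 0 < t < 1: the residue at 1 and a saddle point estimate -/

/-- Splitting off the principal part at v = 1 leaves v^(-ℓ) h(v) with h holomorphic off -1, whose
integral agrees with that over the small circle. Enlarging the circle past 1 adds only the residue β
= ℓ(t-1), which shifts the moment by -(1-t). -/
theorem contour_of_one_mem_ball (t : ℝ) (n : ℕ) {c : ℂ} {R : ℝ} (h0 : (0 : ℂ) ∈ Metric.ball c R)
    (h1 : (1 : ℂ) ∈ Metric.ball c R) (hm : (-1 : ℂ) ∉ Metric.closedBall c R) :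
    contour t (n + 1) c R =
      2 * Real.pi * Complex.I * ((n + 1 : ℕ) * ((moment t (n + 1) - (1 - t) : ℝ) : ℂ)) := by
  set l := n + 1 with hl
  set β : ℂ := l * (t - 1) with hβ
  set E : ℂ → ℂ := fun v => Complex.exp (-(l * (2 * t * (1 - v) / (1 + v)))) with hE
  -- E is v^ℓ X^(-ℓ), with E(1) = 1 and E'(1) = ℓt. Subtracting v^ℓ (1 + β(v-1)) removes the
  -- first-order Taylor part of X^(-ℓ) at 1, so N has a double zero there and N/(v-1)^2 is
  -- holomorphic.
  set N : ℂ → ℂ := fun v => E v - v ^ l - β * (v ^ l * (v - 1)) with hN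
  set U : Set ℂ := {v | v ≠ -1} with hU
  have hUo : IsOpen U := isOpen_ne
  have hEd : ∀ v ∈ U, DifferentiableAt ℂ E v := fun v hv => by
    have : 1 + v ≠ 0 := fun h => hv (by linear_combination h)
    simp only [hE]
    fun_prop (disch := assumption)
  have hNd : DifferentiableOn ℂ N U := fun v hv => by
    have := hEd v hv
    simp only [hN]
    exact DifferentiableAt.differentiableWithinAt (by fun_prop)
  have h1U : (1 : ℂ) ∈ U := by simp only [hU, Set.mem_ofPred_eq]; norm_num
  have hU1 : U ∈ 𝓝 (1 : ℂ) := hUo.mem_nhds h1U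
  have hN1 : N 1 = 0 := by simp [hN, hE]
  have hE' : HasDerivAt E (l * t) 1 := by
    have e1 : HasDerivAt (fun v : ℂ => 2 * t * (1 - v) / (1 + v)) (-t : ℂ) 1 := by
      refine ((((hasDerivAt_id (1 : ℂ)).const_sub 1).const_mul (2 * (t : ℂ))).div
        ((hasDerivAt_id (1 : ℂ)).const_add 1) (by norm_num)).congr_deriv ?_
      simp only [id]
      ring
    refine ((e1.const_mul (l : ℂ)).neg.cexp).congr_deriv ?_
    simp
  have hN' : HasDerivAt N 0 1 := by
    have e2 := hasDerivAt_pow l (1 : ℂ)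
    refine ((hE'.sub e2).sub ((e2.mul ((hasDerivAt_id (1 : ℂ)).sub_const 1)).const_mul β)).congr_deriv ?_
    simp only [hβ, id]
    ring
  set h : ℂ → ℂ := dslope (dslope N 1) 1 with hh
  have hhd : DifferentiableOn ℂ h U :=
    (Complex.differentiableOn_dslope hU1).2 ((Complex.differentiableOn_dslope hU1).2 hNd)
  have hhv : ∀ v, v ≠ 1 → h v = N v / (v - 1) ^ 2 := fun v hv => by
    have hv' : v - 1 ≠ 0 := sub_ne_zero.2 hv
    rw [hh, dslope_of_ne _ hv, slope_def_field, dslope_same, hN'.deriv, dslope_of_ne _ hv,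
      slope_def_field, hN1]
    field_simp
    ring
  have hexp : ∀ v, v ≠ 0 → v ≠ 1 → (diskMap t v ^ l)⁻¹ * (1 / (1 - v) ^ 2) =
      (v ^ l)⁻¹ * h v + ((v - 1) ^ (-2 : ℤ) + β * (v - 1)⁻¹) := fun v hv0 hv1 => by
    have hv' : v - 1 ≠ 0 := sub_ne_zero.2 hv1
    have hv'' : 1 - v ≠ 0 := sub_ne_zero.2 (Ne.symm hv1)
    rw [inv_diskMap_pow, hhv v hv1, zpow_neg, hN, ← neg_sub v 1]
    simp only [hE]
    rw [show (v - 1) ^ (2 : ℤ) = (v - 1) ^ 2 from by norm_cast, neg_sq]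
    field_simp
    ring_nf
  have hRpos : 0 < R := Metric.pos_of_mem_ball h0
  have hcb : Metric.closedBall c R ⊆ U := fun v hv hv' => hm (by rwa [← hv'])
  have gen : ∀ (c : ℂ) (R : ℝ), Metric.closedBall c R ⊆ U → (0 : ℂ) ∈ Metric.ball c R →
      (1 : ℂ) ∉ Metric.sphere c R →
      contour t l c R = (∮ v in C(c, R), (v ^ l)⁻¹ * h v) + β * ∮ v in C(c, R), (v - 1)⁻¹ := by
    intro c R hc h0 h1
    have hR : 0 < R := Metric.pos_of_mem_ball h0
    have hne : ∀ v ∈ Metric.sphere c R, v ≠ 0 := by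
      rintro v hv rfl
      rw [Metric.mem_sphere] at hv
      rw [Metric.mem_ball] at h0
      linarith
    have hne1 : ∀ v ∈ Metric.sphere c R, v - 1 ≠ 0 := fun v hv h => h1 (by rwa [← sub_eq_zero.1 h])
    have i1 : CircleIntegrable (fun v => β * (v - 1)⁻¹) c R :=
      ContinuousOn.circleIntegrable hR.le
        (continuousOn_const.mul (ContinuousOn.inv₀ (by fun_prop) hne1))
    have i2 : CircleIntegrable (fun v => (v - 1) ^ (-2 : ℤ)) c R :=
      ContinuousOn.circleIntegrable hR.le
        (ContinuousOn.zpow₀ (by fun_prop) _ fun v hv => Or.inl (hne1 v hv))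
    rw [contour, circleIntegral.integral_congr hR.le
      (fun v hv => hexp v (hne v hv) (sub_ne_zero.1 (hne1 v hv))), circleIntegral.integral_add,
      circleIntegral.integral_add i2 i1, circleIntegral.integral_sub_zpow_of_ne (by norm_num), zero_add,
      circleIntegral.integral_const_mul]
    · refine ContinuousOn.circleIntegrable hR.le (ContinuousOn.mul ?_
        ((hhd.continuousOn.mono hc).mono Metric.sphere_subset_closedBall))
      exact ContinuousOn.inv₀ (by fun_prop) fun v hv => pow_ne_zero _ (hne v hv)
    · exact i2.add i1
  have hsub : Metric.closedBall (0 : ℂ) (1 / 8) ⊆ U := by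
    intro v hv hv'
    rw [hv'] at hv
    norm_num at hv
  have hsmall := gen 0 (1 / 8) hsub (by simp) (by norm_num)
  have hz : ∮ v in C((0 : ℂ), 1 / 8), (v - 1)⁻¹ = 0 := by
    have hd : ∀ v ∈ Metric.closedBall (0 : ℂ) (1 / 8), DifferentiableAt ℂ (fun v : ℂ => (v - 1)⁻¹) v := by
      intro v hv
      refine DifferentiableAt.inv (by fun_prop) ?_
      rw [← neg_sub, neg_ne_zero]
      exact one_sub_ne_zero_of_norm_lt_one (lt_of_le_of_lt (by simpa using hv) (by norm_num : (1 / 8 : ℝ) < 1))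
    exact Complex.circleIntegral_eq_zero_of_differentiable_on_off_countable (by norm_num)
      Set.countable_empty (fun v hv => (hd v hv).continuousAt.continuousWithinAt)
      (fun v hv => hd v (Metric.ball_subset_closedBall hv.1))
  rw [contour_eq_moment, hz, mul_zero, add_zero,
    circleIntegral_div_pow_eq hUo hsub hcb (by simp) h0 l h hhd] at hsmall
  rw [gen c R hcb h0 (fun h => by
    rw [Metric.mem_sphere] at h
    rw [Metric.mem_ball] at h1
    linarith), ← hsmall, circleIntegral.integral_sub_inv_of_mem_ball h1, hβ]
  simp only [hl]
  push_cast
  ring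

/-- With a = cos α, write cos θ - cos α as -2 sin((θ+α)/2) sin((θ-α)/2). The half sum stays at
distance at least m from 0 and π, and Jordan's inequality bounds the second sine below. -/
theorem exists_le_sq_cos_sub {a : ℝ} (ha : -1 < a) (ha' : a < 1) :
    ∃ κ : ℝ, 0 < κ ∧ ∀ θ ∈ Set.Icc (0 : ℝ) Real.pi,
      κ * (θ - Real.arccos a) ^ 2 ≤ (Real.cos θ - a) ^ 2 := by
  set α := Real.arccos a with hα
  have hα0 : 0 < α := Real.arccos_pos.2 ha'
  have hαpi : α < Real.pi := by
    refine lt_of_le_of_ne (Real.arccos_le_pi a) fun h => ?_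
    rw [hα, Real.arccos_eq_pi] at h
    linarith
  have hcos : Real.cos α = a := Real.cos_arccos ha.le ha'.le
  set m := min (α / 2) ((Real.pi - α) / 2) with hm
  have hm0 : 0 < m := lt_min (by linarith) (by linarith)
  have hmpi : m ≤ Real.pi / 2 := (min_le_left _ _).trans (by linarith)
  have hsm : 0 < Real.sin m := Real.sin_pos_of_pos_of_lt_pi hm0 (by linarith [Real.pi_pos])
  refine ⟨(2 * Real.sin m / Real.pi) ^ 2, by positivity, fun θ hθ => ?_⟩
  have h1 : Real.cos θ - a = -2 * Real.sin ((θ + α) / 2) * Real.sin ((θ - α) / 2) := by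
    rw [← hcos, Real.cos_sub_cos]
  have h2 : Real.sin m ≤ Real.sin ((θ + α) / 2) := by
    have hm1 := min_le_left (α / 2) ((Real.pi - α) / 2)
    have hm2 := min_le_right (α / 2) ((Real.pi - α) / 2)
    rw [← hm] at hm1 hm2
    rcases le_total ((θ + α) / 2) (Real.pi / 2) with h | h
    · exact Real.sin_le_sin_of_le_of_le_pi_div_two (by linarith [Real.pi_pos]) h (by linarith [hθ.1])
    · rw [← Real.sin_pi_sub ((θ + α) / 2)]
      exact Real.sin_le_sin_of_le_of_le_pi_div_two (by linarith [Real.pi_pos]) (by linarith)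
        (by linarith [hθ.2])
  have h3 : |θ - α| / Real.pi ≤ |Real.sin ((θ - α) / 2)| := by
    have := Real.mul_abs_le_abs_sin (x := (θ - α) / 2) (by
      rw [abs_le]; constructor <;> linarith [hθ.1, hθ.2])
    refine le_trans (le_of_eq ?_) this
    rw [abs_div, abs_of_pos (by norm_num : (0 : ℝ) < 2)]
    ring
  have h4 : (|θ - α| / Real.pi) ^ 2 ≤ Real.sin ((θ - α) / 2) ^ 2 := by
    rw [← sq_abs (Real.sin _)]
    exact pow_le_pow_left₀ (by positivity) h3 2
  have h5 : Real.sin m ^ 2 ≤ Real.sin ((θ + α) / 2) ^ 2 := pow_le_pow_left₀ hsm.le h2 2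
  rw [h1]
  calc (2 * Real.sin m / Real.pi) ^ 2 * (θ - α) ^ 2
      = 4 * (Real.sin m ^ 2 * (|θ - α| / Real.pi) ^ 2) := by rw [div_pow |_|, sq_abs]; ring
    _ ≤ 4 * (Real.sin ((θ + α) / 2) ^ 2 * Real.sin ((θ - α) / 2) ^ 2) := by gcongr
    _ = _ := by ring

theorem exists_exp_sq_cos_sub_le {a : ℝ} (ha : -1 < a) (ha' : a < 1) :
    ∃ κ : ℝ, 0 < κ ∧ ∀ s : ℝ, 0 ≤ s → ∀ θ ∈ Set.Icc (-Real.pi) Real.pi,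
      Real.exp (-(s * (Real.cos θ - a) ^ 2)) ≤
        Real.exp (-(κ * s) * (θ - Real.arccos a) ^ 2) +
        Real.exp (-(κ * s) * (θ - -Real.arccos a) ^ 2) := by
  obtain ⟨κ, hκ, h⟩ := exists_le_sq_cos_sub ha ha'
  refine ⟨κ, hκ, fun s hs θ hθ => ?_⟩
  rcases le_total 0 θ with h0 | h0
  · refine le_trans (Real.exp_le_exp.2 ?_) (le_add_of_nonneg_right (Real.exp_pos _).le)
    have := mul_le_mul_of_nonneg_left (h θ ⟨h0, hθ.2⟩) hs
    linarith
  · refine le_trans (Real.exp_le_exp.2 ?_) (le_add_of_nonneg_left (Real.exp_pos _).le)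
    have := mul_le_mul_of_nonneg_left (h (-θ) ⟨by linarith, by linarith [hθ.1]⟩) hs
    rw [Real.cos_neg] at this
    nlinarith

/-- On the circle with centre `1/4` through the critical points of `diskMap t`, the modulus
of `diskMap t` is at least one, with a quadratic lower bound. -/
theorem norm_diskMap_ge {t : ℝ} (ht0 : 0 < t) (ht1 : t < 1) {v : ℂ} {y : ℝ}
    (hA : ‖v‖ ^ 2 = 1 + y / 2) (hB : ‖1 + v‖ ^ 2 = 4 * t + 5 / 2 * y) (hv0 : v ≠ 0) (hv1 : 1 + v ≠ 0)
    (hv : ‖v‖ ≤ 3 / 2) : Real.exp (y ^ 2 / 128) ≤ ‖diskMap t v‖ := by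
  have hn0 : 0 < ‖v‖ := norm_pos_iff.2 hv0
  have hn1 : 0 < ‖1 + v‖ := norm_pos_iff.2 hv1
  have hn2 : ‖1 + v‖ ≤ 5 / 2 := (norm_add_le _ _).trans (by rw [norm_one]; linarith)
  set A := 1 + y / 2 with hAdef
  set B := 4 * t + 5 / 2 * y with hBdef
  have hA0 : 0 < A := by rw [← hA]; positivity
  have hB0 : 0 < B := by rw [← hB]; positivity
  have hA1 : A ≤ 9 / 4 := by rw [← hA]; nlinarith
  have hB1 : B ≤ 25 / 4 := by rw [← hB]; nlinarith
  have h1 : Real.exp ((1 - 1 / A) / 2) ≤ ‖v‖ := by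
    rw [← Real.le_log_iff_exp_le hn0]
    have := Real.one_sub_inv_le_log_of_pos hA0
    rw [← hA, Real.log_pow, hA] at this
    push_cast at this
    rw [one_div]
    linarith
  rw [norm_diskMap, hA, hB]
  refine le_trans ?_ (mul_le_mul_of_nonneg_right h1 (Real.exp_pos _).le)
  rw [← Real.exp_add, Real.exp_le_exp]
  -- The part linear in y cancels, since y = 0 marks the critical points. Then AB ≤ 225/16 and 5/2 -
  -- 2t > 1/2 give the constant 128.
  have e : (1 - 1 / A) / 2 + 2 * t * ((1 - A) / B) = y ^ 2 * (5 / 2 - 2 * t) / (4 * (A * B)) := by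
    field_simp
    rw [hAdef, hBdef]
    ring
  rw [e, le_div_iff₀ (by positivity)]
  have h2 : A * B ≤ 9 / 4 * (25 / 4) := mul_le_mul hA1 hB1 hB0.le (by norm_num)
  have h3 : 0 ≤ y ^ 2 := sq_nonneg y
  nlinarith

/-- On the circle through the critical points, |X|^(-ℓ) is dominated by two Gaussians of width of
order ℓ^(-1/2), and 1/(1-v)^2 is bounded. The integral is O(ℓ^(-1/2)), and the factor ℓ in front of
the moment gives the exponent -3/2. -/
theorem exists_abs_moment_sub_le {t : ℝ} (ht0 : 0 < t) (ht1 : t < 1) :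
    ∃ C : ℝ, ∀ n : ℕ, |moment t (n + 1) - (1 - t)| ≤ C * ((n : ℝ) + 1) ^ (-(3 / 2) : ℝ) := by
  -- The critical points lie on the unit circle with real part 2t-1, at squared distance 25/16 - t
  -- from 1/4. The bounds 3/4 < ρ < 5/4 put 0 and 1 inside the circle and -1 outside.
  set ρ := Real.sqrt (25 / 16 - t) with hρ
  have hρsq : ρ ^ 2 = 25 / 16 - t := Real.sq_sqrt (by linarith)
  have hρ1 : 3 / 4 < ρ := by rw [hρ]; apply Real.lt_sqrt_of_sq_lt; linarith
  have hρ2 : ρ < 5 / 4 := by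
    rw [hρ, Real.sqrt_lt' (by norm_num)]; linarith
  have hρ0 : 0 < ρ := by linarith
  set a := (2 * t - 5 / 4) / ρ with ha
  have ha1 : -1 < a := by
    rw [ha, lt_div_iff₀ hρ0]
    nlinarith
  have ha2 : a < 1 := by
    rw [ha, div_lt_iff₀ hρ0]
    nlinarith
  have haρ : ρ * a = 2 * t - 5 / 4 := by rw [ha]; field_simp
  obtain ⟨κ, hκ, hexp⟩ := exists_exp_sq_cos_sub_le ha1 ha2
  set α := Real.arccos a
  set M := 1 / (ρ - 3 / 4) ^ 2 with hM
  have hM0 : 0 < M := by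
    have : 0 < ρ - 3 / 4 := by linarith
    positivity
  set c : ℂ := ((1 / 4 : ℝ) : ℂ) with hc
  set b := κ * (ρ ^ 2 / 128) with hb
  have hb0 : 0 < b := by positivity
  have hd0 : ∀ x : ℝ, dist (x : ℂ) c = |x - 1 / 4| := fun x => by
    rw [hc, dist_eq_norm, ← Complex.ofReal_sub, Complex.norm_real, Real.norm_eq_abs]
  have hm0 : (0 : ℂ) ∈ Metric.ball c ρ := by
    have := hd0 0
    rw [Metric.mem_ball]
    rw [Complex.ofReal_zero] at this
    rw [this]; norm_num; linarith
  have hm1 : (1 : ℂ) ∈ Metric.ball c ρ := by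
    have := hd0 1
    rw [Metric.mem_ball]
    rw [Complex.ofReal_one] at this
    rw [this]; norm_num; linarith
  have hm2 : (-1 : ℂ) ∉ Metric.closedBall c ρ := by
    have := hd0 (-1)
    rw [Metric.mem_closedBall]
    rw [Complex.ofReal_neg, Complex.ofReal_one] at this
    rw [this]; norm_num; linarith
  have hpt : ∀ (n : ℕ), ∀ θ ∈ Set.Icc (-Real.pi) Real.pi,
      ‖(diskMap t (circleMap c ρ θ) ^ (n + 1))⁻¹ * (1 / (1 - circleMap c ρ θ) ^ 2)‖ ≤
        M * (Real.exp (-(b * (n + 1)) * (θ - α) ^ 2) + Real.exp (-(b * (n + 1)) * (θ - -α) ^ 2)) := by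
    intro n θ hθ
    set v := circleMap c ρ θ with hv
    have hvs : dist v c = ρ := circleMap_mem_sphere c hρ0.le θ
    have hv0 : v ≠ 0 := fun h => by rw [h] at hvs; rw [Metric.mem_ball] at hm0; linarith
    have hv1 : 1 + v ≠ 0 := fun h => by
      rw [show v = -1 by linear_combination h] at hvs
      exact hm2 (Metric.mem_closedBall.2 hvs.le)
    have hre : v.re = 1 / 4 + ρ * Real.cos θ := by
      simp [hv, hc, circleMap, Complex.exp_ofReal_mul_I_re]
    have him : v.im = ρ * Real.sin θ := by
      simp [hv, hc, circleMap, Complex.exp_ofReal_mul_I_im]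
    -- This is Re v - (2t-1), the horizontal displacement from the critical points.
    set y := ρ * (Real.cos θ - a) with hy
    have hcs := Real.sin_sq_add_cos_sq θ
    have hA : ‖v‖ ^ 2 = 1 + y / 2 := by
      rw [← Complex.normSq_eq_norm_sq, Complex.normSq_apply, hre, him, hy]
      linear_combination ρ ^ 2 * hcs + hρsq + 1 / 2 * haρ
    have hB : ‖1 + v‖ ^ 2 = 4 * t + 5 / 2 * y := by
      rw [← Complex.normSq_eq_norm_sq, Complex.normSq_apply, Complex.add_re, Complex.add_im, hre, him, hy,
        Complex.one_re, Complex.one_im]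
      linear_combination ρ ^ 2 * hcs + hρsq + 5 / 2 * haρ
    have hvn : ‖v‖ ≤ 3 / 2 := by
      have h1 : ‖v‖ ≤ ‖v - c‖ + ‖c‖ := by simpa using norm_add_le (v - c) c
      rw [← dist_eq_norm, hvs, hc, Complex.norm_real, Real.norm_eq_abs] at h1
      norm_num at h1
      linarith
    have h1v : ρ - 3 / 4 ≤ ‖1 - v‖ := by
      have h2 := dist_triangle v 1 c
      have h3 := hd0 1
      rw [Complex.ofReal_one] at h3
      rw [hvs, h3, dist_comm, dist_eq_norm] at h2
      norm_num at h2
      linarith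
    have hX := norm_diskMap_ge ht0 ht1 hA hB hv0 hv1 hvn
    have h4 : 0 < ρ - 3 / 4 := by linarith
    rw [norm_mul, norm_inv, norm_pow, norm_div, norm_one, norm_pow, mul_comm]
    refine mul_le_mul (by rw [hM]; gcongr) ?_ (by positivity) hM0.le
    have h5 := hexp (ρ ^ 2 / 128 * (n + 1)) (by positivity) θ hθ
    rw [← mul_assoc, ← hb] at h5
    refine le_trans ?_ h5
    rw [Real.exp_neg]
    refine inv_anti₀ (Real.exp_pos _) ?_
    calc Real.exp (ρ ^ 2 / 128 * (n + 1) * (Real.cos θ - a) ^ 2) = Real.exp (y ^ 2 / 128) ^ (n + 1) := by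
          rw [← Real.exp_nat_mul, hy]; congr 1; push_cast; ring
      _ ≤ _ := pow_le_pow_left₀ (Real.exp_pos _).le hX _
  refine ⟨ρ * (M * (2 * Real.sqrt (Real.pi / b))) / (2 * Real.pi), fun n => ?_⟩
  have hbn : 0 < b * ((n : ℝ) + 1) := by positivity
  have hi := integrable_exp_neg_mul_sq hbn
  have h := norm_circleIntegral_le_of_le_integrable
    (f := fun v => (diskMap t v ^ (n + 1))⁻¹ * (1 / (1 - v) ^ 2)) (c := c) hρ0.le
    (((hi.comp_sub_right α).add (hi.comp_sub_right (-α))).const_mul M)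
    (fun θ => by
      simp only [Pi.zero_apply, Pi.add_apply]
      positivity) (hpt n)
  have hI : ∫ θ : ℝ, M * ((fun x => Real.exp (-(b * (n + 1)) * (x - α) ^ 2)) +
      fun x => Real.exp (-(b * (n + 1)) * (x - -α) ^ 2)) θ =
      M * (2 * Real.sqrt (Real.pi / (b * (n + 1)))) := by
    rw [integral_const_mul]
    congr 1
    simp only [Pi.add_apply]
    rw [integral_add (hi.comp_sub_right α) (hi.comp_sub_right (-α)),
      integral_sub_right_eq_self (fun x => Real.exp (-(b * (n + 1)) * x ^ 2)) α,
      integral_sub_right_eq_self (fun x => Real.exp (-(b * (n + 1)) * x ^ 2)) (-α), integral_gaussian]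
    ring
  rw [hI] at h
  have hcon := contour_of_one_mem_ball t n hm0 hm1 hm2
  rw [contour] at hcon
  rw [hcon] at h
  simp only [norm_mul, Complex.norm_natCast, Complex.norm_real, Complex.norm_I, Real.norm_eq_abs,
    abs_of_pos Real.pi_pos, RCLike.norm_ofNat] at h
  push_cast at h
  have hn : (0 : ℝ) < (n : ℝ) + 1 := by positivity
  have hpow : ((n : ℝ) + 1) ^ (-(3 / 2) : ℝ) = Real.sqrt (((n : ℝ) + 1)⁻¹) / ((n : ℝ) + 1) := by
    rw [Real.sqrt_eq_rpow, Real.inv_rpow hn.le, ← Real.rpow_neg hn.le,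
      show (-(3 / 2) : ℝ) = -(1 / 2) - 1 by norm_num, Real.rpow_sub hn, Real.rpow_one]
  have hsq : Real.sqrt (Real.pi / (b * (n + 1))) = Real.sqrt (Real.pi / b) * Real.sqrt (((n : ℝ) + 1)⁻¹) := by
    rw [← Real.sqrt_mul (by positivity)]
    congr 1
    field_simp
  rw [hsq] at h
  rw [hpow]
  have hp := Real.pi_pos
  rw [← sub_nonneg] at h ⊢
  have h6 : 0 < (2 * Real.pi * ((n : ℝ) + 1)) := by positivity
  refine nonneg_of_mul_nonneg_right (a := (2 * Real.pi * ((n : ℝ) + 1))) ?_ h6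
  refine h.trans (le_of_eq ?_)
  field_simp

theorem summable_moment_sub {t : ℝ} (ht0 : 0 < t) (ht1 : t < 1) :
    Summable fun n => |moment t (n + 1) - (1 - t)| := by
  obtain ⟨C, hC⟩ := exists_abs_moment_sub_le ht0 ht1
  have h : Summable fun n : ℕ => C * ((n : ℝ) + 1) ^ (-(3 / 2) : ℝ) := by
    have := (summable_nat_add_iff 1).2 (Real.summable_nat_rpow.2 (by norm_num : (-(3 / 2) : ℝ) < -1))
    push_cast at this
    exact this.mul_left C
  exact h.of_nonneg_of_le (fun _ => abs_nonneg _) hC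

/-! ### The critical case t = 1: moments and their differences -/

/-- In log |X| the terms in ε and ε^2 cancel between log(1-ε) and (1-|v|^2)/D, leaving a loss of at
most 3ε^3. The parallelogram law gives |1+v|^2 = 2D - |1-v|^2, and this shrinking denominator yields
the gain ε|1-v|^2/8. -/
theorem norm_diskMap_one_ge {v : ℂ} {ε : ℝ} (hε0 : 0 < ε) (hε : ε ≤ 1 / 2) (hv : ‖v‖ = 1 - ε) :
    Real.exp (-(3 * ε ^ 3) + ε * ‖1 - v‖ ^ 2 / 8) ≤ ‖diskMap 1 v‖ := by
  have hr0 : 0 < 1 - ε := by linarith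
  have hv1 : 1 + v ≠ 0 := one_add_ne_zero_of_norm_lt_one (by linarith)
  set A := ‖1 - v‖ ^ 2 with hA
  set D := 1 + (1 - ε) ^ 2 with hD
  have hpar : ‖1 + v‖ ^ 2 = 2 * D - A := by
    have := parallelogram_law_with_norm ℝ (1 : ℂ) v
    rw [norm_one, hv] at this
    rw [hA, hD]
    linarith
  have hpos : 0 < 2 * D - A := by rw [← hpar]; positivity
  have hA0 : 0 ≤ A := by positivity
  have hD1 : 1 ≤ D := by rw [hD]; nlinarith [sq_nonneg (1 - ε)]
  have hD2 : D ≤ 2 := by rw [hD]; nlinarith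
  have hlog : -(ε + ε ^ 2 / 2 + 2 * ε ^ 3) ≤ Real.log (1 - ε) := by
    have h1 := Real.abs_log_sub_add_sum_range_le (x := ε) (by rw [abs_of_pos hε0]; linarith) 2
    rw [abs_of_pos hε0, Finset.sum_range_succ, Finset.sum_range_one] at h1
    have h2 : ε ^ (2 + 1) / (1 - ε) ≤ 2 * ε ^ 3 := by
      rw [div_le_iff₀ hr0, show ε ^ (2 + 1) = ε ^ 3 from rfl]
      have : 0 < ε ^ 3 := by positivity
      nlinarith [mul_nonneg this.le (by linarith : 0 ≤ 1 - 2 * ε)]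
    have h3 := (abs_le.1 h1).1
    norm_num at h3
    linarith
  have h4 : ε + ε ^ 2 / 2 - ε ^ 3 ≤ (1 - (1 - ε) ^ 2) / D := by
    rw [le_div_iff₀ (by linarith), hD]
    have h5 : 0 < ε ^ 3 := by positivity
    nlinarith [mul_pos h5 hε0, mul_pos h5 (mul_pos hε0 hε0)]
  have h6 : (1 - (1 - ε) ^ 2) / D + ε * A / 8 ≤ 2 * (1 - (1 - ε) ^ 2) / (2 * D - A) := by
    have h7 : 2 * (1 - (1 - ε) ^ 2) / (2 * D - A) - (1 - (1 - ε) ^ 2) / D =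
        (1 - (1 - ε) ^ 2) * A / (D * (2 * D - A)) := by
      have : D ≠ 0 := by linarith
      field_simp
      ring
    have h8 : ε * A / 8 ≤ (1 - (1 - ε) ^ 2) * A / (D * (2 * D - A)) := by
      have h9 : D * (2 * D - A) ≤ 8 := by nlinarith
      have h10 : ε * A ≤ (1 - (1 - ε) ^ 2) * A := mul_le_mul_of_nonneg_right (by nlinarith) hA0
      exact div_le_div₀ (le_trans (by positivity) h10) h10 (by positivity) h9
    linarith
  rw [norm_diskMap, hv, hpar, ← Real.exp_log hr0, ← Real.exp_add, Real.exp_le_exp, Real.exp_log hr0,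
    mul_one, ← mul_div_assoc]
  linarith

/-- The derivative of 1/X has a double zero at 1, so the mean value inequality gives a cubic bound
near 1. For |1-v| ≥ 1/2 the trivial bound 1 + 2 = 3 is already at most 24/8. -/
theorem norm_one_sub_inv_diskMap_one_le {v : ℂ} (hv : 1 / 2 ≤ ‖v‖) (hv' : ‖v‖ < 1) :
    ‖1 - (diskMap 1 v)⁻¹‖ ≤ 24 * ‖1 - v‖ ^ 3 := by
  set δ := ‖1 - v‖ with hδ
  rcases lt_or_ge δ (1 / 2) with h | h
  · have hδ0 : 0 ≤ δ := norm_nonneg _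
    have hball : ∀ z ∈ Metric.closedBall (1 : ℂ) δ, 1 / 2 ≤ ‖z‖ ∧ 3 / 2 ≤ ‖1 + z‖ ∧ ‖1 - z‖ ≤ δ := by
      intro z hz
      rw [Metric.mem_closedBall, dist_comm, dist_eq_norm] at hz
      refine ⟨?_, ?_, hz⟩
      · have h1 := norm_sub_le_norm_add (1 : ℂ) (-(1 - z))
        rw [norm_one, norm_neg, show (1 : ℂ) + -(1 - z) = z by ring] at h1
        linarith
      · have h1 := norm_sub_le_norm_add (2 : ℂ) (-(1 - z))
        rw [RCLike.norm_ofNat, norm_neg, show (2 : ℂ) + -(1 - z) = 1 + z by ring] at h1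
        linarith
    have hd : ∀ z ∈ Metric.closedBall (1 : ℂ) δ, HasDerivWithinAt (fun z => (diskMap 1 z)⁻¹)
        (-(Complex.exp (2 * (1 : ℝ) * (1 - z) / (1 + z)) * (1 - 4 * (1 : ℝ) * z / (1 + z) ^ 2)) /
          diskMap 1 z ^ 2) (Metric.closedBall 1 δ) z := by
      intro z hz
      obtain ⟨h1, h2, h3⟩ := hball z hz
      have hz0 : z ≠ 0 := norm_pos_iff.1 (by linarith)
      have hz1 : 1 + z ≠ 0 := norm_pos_iff.1 (by linarith)
      exact ((hasDerivAt_diskMap 1 hz1).inv (diskMap_ne_zero hz0)).hasDerivWithinAt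
    have hb : ∀ z ∈ Metric.closedBall (1 : ℂ) δ,
        ‖-(Complex.exp (2 * (1 : ℝ) * (1 - z) / (1 + z)) * (1 - 4 * (1 : ℝ) * z / (1 + z) ^ 2)) /
          diskMap 1 z ^ 2‖ ≤ 24 * δ ^ 2 := by
      intro z hz
      obtain ⟨h1, h2, h3⟩ := hball z hz
      have hz0 : z ≠ 0 := norm_pos_iff.1 (by linarith)
      have hz1 : 1 + z ≠ 0 := norm_pos_iff.1 (by linarith)
      set e := 2 * (1 - z) / (1 + z) with he
      have hen : ‖e‖ ≤ 1 := by
        rw [he, norm_div, norm_mul, RCLike.norm_ofNat, div_le_one (by linarith)]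
        linarith
      have h5 : -(Complex.exp (2 * (1 : ℝ) * (1 - z) / (1 + z)) * (1 - 4 * (1 : ℝ) * z / (1 + z) ^ 2)) /
          diskMap 1 z ^ 2 = -(Complex.exp (-e) * (1 - z) ^ 2 / (z ^ 2 * (1 + z) ^ 2)) := by
        rw [diskMap, Complex.exp_neg, he]
        simp only [Complex.ofReal_one, mul_one]
        have := Complex.exp_ne_zero (2 * (1 - z) / (1 + z))
        field_simp
        ring
      have h6 : ‖Complex.exp (-e)‖ ≤ 3 := by
        rw [Complex.norm_exp]
        have h7 : (-e).re ≤ 1 := (Complex.re_le_norm _).trans (by rwa [norm_neg])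
        exact (Real.exp_le_exp.2 h7).trans (by linarith [Real.exp_one_lt_d9])
      rw [h5, norm_neg, norm_div, norm_mul, norm_mul, norm_pow, norm_pow, norm_pow,
        div_le_iff₀ (by positivity)]
      have h8 : (1 / 2 : ℝ) ^ 2 * (3 / 2) ^ 2 ≤ ‖z‖ ^ 2 * ‖1 + z‖ ^ 2 := by gcongr
      have h9 : ‖1 - z‖ ^ 2 ≤ δ ^ 2 := pow_le_pow_left₀ (norm_nonneg _) h3 2
      calc ‖Complex.exp (-e)‖ * ‖1 - z‖ ^ 2 ≤ 3 * δ ^ 2 := by gcongr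
        _ ≤ 24 * δ ^ 2 * ((1 / 2 : ℝ) ^ 2 * (3 / 2) ^ 2) := by nlinarith [sq_nonneg δ]
        _ ≤ _ := by gcongr
    have hm := (convex_closedBall (1 : ℂ) δ).norm_image_sub_le_of_norm_hasDerivWithin_le hd hb
      (x := v) (y := 1) (by rw [Metric.mem_closedBall, dist_comm, dist_eq_norm])
      (Metric.mem_closedBall_self hδ0)
    rw [show (diskMap 1 1)⁻¹ = (1 : ℂ) by simp [diskMap]] at hm
    refine hm.trans (le_of_eq ?_)
    rw [← hδ]; ring
  · have h1 : ‖(diskMap 1 v)⁻¹‖ ≤ 2 := by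
      rw [norm_inv, norm_diskMap]
      refine inv_le_of_inv_le₀ (by norm_num) ?_
      have h2 : (1 : ℝ) ≤ Real.exp (2 * 1 * ((1 - ‖v‖ ^ 2) / ‖1 + v‖ ^ 2)) := by
        rw [Real.one_le_exp_iff]
        have : 0 ≤ 1 - ‖v‖ ^ 2 := by nlinarith [norm_nonneg v]
        positivity
      nlinarith
    have h3 := norm_sub_le (1 : ℂ) (diskMap 1 v)⁻¹
    rw [norm_one] at h3
    have h4 : (1 / 2 : ℝ) ^ 3 ≤ δ ^ 3 := by gcongr
    linarith

/-- The radius of the contour used at the critical parameter is `1 - contourGap n`. -/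
noncomputable def contourGap (n : ℕ) : ℝ := (8 * ((n : ℝ) + 1)) ^ (-(1 / 3) : ℝ)

theorem contourGap_pos (n : ℕ) : 0 < contourGap n := Real.rpow_pos_of_pos (by positivity) _

theorem contourGap_cube (n : ℕ) : contourGap n ^ 3 * (8 * ((n : ℝ) + 1)) = 1 := by
  have h : (0 : ℝ) < 8 * ((n : ℝ) + 1) := by positivity
  rw [contourGap, ← Real.rpow_natCast, ← Real.rpow_mul h.le]
  norm_num
  rw [Real.rpow_neg_one]
  field_simp

theorem contourGap_le_half (n : ℕ) : contourGap n ≤ 1 / 2 := by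
  by_contra! h
  have h1 := contourGap_cube n
  have h2 : (1 / 2 : ℝ) ^ 3 < contourGap n ^ 3 := by gcongr
  have h3 : (1 : ℝ) ≤ n + 1 := by linarith [n.cast_nonneg (α := ℝ)]
  nlinarith

theorem contourGap_sq_le (n : ℕ) : contourGap n ^ 2 ≤ ((n : ℝ) + 1) ^ (-(2 / 3) : ℝ) := by
  have hn : (0 : ℝ) < (n : ℝ) + 1 := by positivity
  have h : (0 : ℝ) < 8 * ((n : ℝ) + 1) := by positivity
  rw [contourGap, ← Real.rpow_natCast, ← Real.rpow_mul h.le]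
  norm_num
  exact Real.rpow_le_rpow_of_nonpos hn (by linarith) (by norm_num)

theorem norm_contour_integrand_le (n : ℕ) {θ : ℝ} (hθ : θ ∈ Set.Icc (-Real.pi) Real.pi) :
    (contourGap n) ^ 2 ≤ ‖1 - circleMap 0 (1 - contourGap n) θ‖ ^ 2 ∧
    θ ^ 2 / 8 ≤ ‖1 - circleMap 0 (1 - contourGap n) θ‖ ^ 2 ∧
    ‖(diskMap 1 (circleMap 0 (1 - contourGap n) θ) ^ (n + 1))⁻¹‖ ≤
      2 * Real.exp (-(‖1 - circleMap 0 (1 - contourGap n) θ‖ ^ 2 / (64 * contourGap n ^ 2))) := by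
  set ε := contourGap n with hε
  have hε0 : 0 < ε := contourGap_pos n
  have hε1 : ε ≤ 1 / 2 := contourGap_le_half n
  have hcube := contourGap_cube n
  rw [← hε] at hcube
  set v := circleMap 0 (1 - ε) θ with hv
  have hvn : ‖v‖ = 1 - ε := by
    rw [hv, norm_circleMap_zero, abs_of_pos (by linarith)]
  have hre : v.re = (1 - ε) * Real.cos θ := by
    simp [hv, circleMap, Complex.exp_ofReal_mul_I_re]
  have hA : ‖1 - v‖ ^ 2 = ε ^ 2 + 4 * (1 - ε) * Real.sin (θ / 2) ^ 2 := by
    have h1 : ‖1 - v‖ ^ 2 = 1 - 2 * v.re + ‖v‖ ^ 2 := by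
      rw [← Complex.normSq_eq_norm_sq, ← Complex.normSq_eq_norm_sq, Complex.normSq_apply,
        Complex.normSq_apply]
      simp
      ring
    have h2 : Real.cos θ = 1 - 2 * Real.sin (θ / 2) ^ 2 := by
      have := Real.cos_two_mul (θ / 2)
      rw [mul_div_cancel₀ θ two_ne_zero] at this
      have h3 := Real.sin_sq_add_cos_sq (θ / 2)
      linarith
    rw [h1, hvn, hre, h2]
    ring
  have hs : (θ / Real.pi) ^ 2 ≤ Real.sin (θ / 2) ^ 2 := by
    have := Real.mul_abs_le_abs_sin (x := θ / 2) (by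
      rw [abs_le]; constructor <;> linarith [hθ.1, hθ.2])
    rw [abs_div, abs_of_pos (by norm_num : (0 : ℝ) < 2)] at this
    rw [← sq_abs, ← sq_abs (Real.sin _), abs_div, abs_of_pos Real.pi_pos]
    refine pow_le_pow_left₀ (by positivity) (le_trans (le_of_eq ?_) this) 2
    ring
  have hp : (θ / Real.pi) ^ 2 ≥ θ ^ 2 / 16 := by
    rw [div_pow]
    have : Real.pi ^ 2 ≤ 16 := by nlinarith [Real.pi_pos, Real.pi_le_four]
    gcongr
  refine ⟨?_, ?_, ?_⟩
  · rw [hA]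
    have : 0 ≤ 4 * (1 - ε) * Real.sin (θ / 2) ^ 2 := mul_nonneg (by linarith) (sq_nonneg _)
    linarith
  · rw [hA]
    have : 2 * Real.sin (θ / 2) ^ 2 ≤ 4 * (1 - ε) * Real.sin (θ / 2) ^ 2 :=
      mul_le_mul_of_nonneg_right (by linarith) (sq_nonneg _)
    nlinarith [sq_nonneg ε]
  · have hX := norm_diskMap_one_ge hε0 hε1 hvn
    rw [norm_inv, norm_pow]
    have h1 := pow_le_pow_left₀ (Real.exp_pos _).le hX (n + 1)
    rw [← Real.exp_nat_mul] at h1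
    refine (inv_anti₀ (Real.exp_pos _) h1).trans ?_
    rw [← Real.exp_neg]
    -- The gap satisfies (n+1)ε^3 = 1/8, so the loss 3(n+1)ε^3 is the constant 3/8 and the gain
    -- becomes |1-v|^2/(64ε^2).
    have h2 : -(((n + 1 : ℕ) : ℝ) * (-(3 * ε ^ 3) + ε * ‖1 - v‖ ^ 2 / 8)) =
        3 / 8 + -(‖1 - v‖ ^ 2 / (64 * ε ^ 2)) := by
      have hn : (n : ℝ) + 1 = 1 / (8 * ε ^ 3) := by
        field_simp
        linarith
      push_cast
      rw [hn]
      field_simp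
      ring
    rw [h2, Real.exp_add]
    gcongr
    have h3 : Real.exp (3 / 8 : ℝ) ≤ 2 := by
      have h4 := Real.exp_bound_div_one_sub_of_interval (x := 3 / 8) (by norm_num) (by norm_num)
      norm_num at h4 ⊢
      linarith
    exact h3

theorem integral_gaussian_contourGap (n : ℕ) {s : ℝ} (hs : 0 < s) (K : ℝ) :
    Integrable (fun θ : ℝ => K * Real.exp (-(s / contourGap n ^ 2) * θ ^ 2)) ∧
    ∫ θ : ℝ, K * Real.exp (-(s / contourGap n ^ 2) * θ ^ 2) =
      K * (Real.sqrt (Real.pi / s) * contourGap n) := by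
  have h := contourGap_pos n
  refine ⟨(integrable_exp_neg_mul_sq (by positivity)).const_mul K, ?_⟩
  rw [integral_const_mul, integral_gaussian, div_div_eq_mul_div, mul_div_right_comm,
    Real.sqrt_mul (by positivity), Real.sqrt_sq h.le]

/-- The integrand is at most 2ε^(-2) times a Gaussian of width of order ε, so the integral is
O(1/ε). Dividing by n+1 = 1/(8ε^3) leaves ε^2. -/
theorem exists_abs_moment_one_le :
    ∃ C : ℝ, 0 ≤ C ∧ ∀ n : ℕ, |moment 1 (n + 1)| ≤ C * contourGap n ^ 2 := by
  refine ⟨2 * Real.sqrt (Real.pi / (1 / 512)) * 8, by positivity, fun n => ?_⟩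
  have hε0 := contourGap_pos n
  have hε1 := contourGap_le_half n
  have hcube := contourGap_cube n
  obtain ⟨hi, hI⟩ := integral_gaussian_contourGap n (s := 1 / 512) (by norm_num)
    (2 * (1 / contourGap n ^ 2))
  have h := norm_circleIntegral_le_of_le_integrable
    (f := fun v => (diskMap 1 v ^ (n + 1))⁻¹ * (1 / (1 - v) ^ 2)) (c := 0)
    (r := 1 - contourGap n) (by linarith) hi (fun θ => by
      simp only [Pi.zero_apply]
      positivity) (fun θ hθ => by
      obtain ⟨h1, h2, h3⟩ := norm_contour_integrand_le n hθ
      set A := ‖1 - circleMap 0 (1 - contourGap n) θ‖ ^ 2 with hA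
      rw [norm_mul, norm_div, norm_one, norm_pow (1 - _), ← hA, mul_right_comm]
      refine mul_le_mul (h3.trans ?_) ?_ (by positivity) (by positivity)
      · gcongr
        rw [neg_mul, neg_le_neg_iff, div_mul_eq_mul_div]
        rw [div_le_div_iff₀ (by positivity) (by positivity)]
        nlinarith [sq_nonneg (contourGap n)]
      · gcongr)
  rw [hI] at h
  have h4 : ‖contour 1 (n + 1) 0 (1 - contourGap n)‖ ≤ _ := h
  rw [← norm_moment_eq 1 n (by linarith) (by linarith)] at h4
  set ε := contourGap n
  set S := Real.sqrt (Real.pi / (1 / 512))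
  have hS : 0 ≤ S := Real.sqrt_nonneg _
  have hn : (n : ℝ) + 1 = 1 / (8 * ε ^ 3) := by
    field_simp
    linarith
  have h5 : (1 - ε) * (2 * (1 / ε ^ 2) * (S * ε)) ≤ 2 * S / ε := by
    rw [show 2 * (1 / ε ^ 2) * (S * ε) = 2 * S / ε by field_simp]
    exact mul_le_of_le_one_left (by positivity) (by linarith)
  have h6 : ((n : ℝ) + 1) * |moment 1 (n + 1)| ≤ 2 * S / ε := by
    refine le_trans ?_ (h4.trans h5)
    refine mul_le_mul_of_nonneg_right ?_ (abs_nonneg _)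
    have : (1 : ℝ) ≤ 2 * Real.pi := by linarith [Real.pi_gt_three]
    nlinarith [n.cast_nonneg (α := ℝ)]
  rw [hn, div_mul_eq_mul_div, one_mul, div_le_div_iff₀ (by positivity) hε0] at h6
  have h7 : |moment 1 (n + 1)| * ε ≤ (2 * S * 8 * ε ^ 2) * ε := by nlinarith
  exact le_of_mul_le_mul_right h7 hε0

/-- Subtracting consecutive contours inserts 1 - 1/X = O(|1-v|^3), which beats the pole and gives an
integral O(ε^2). This controls ℓ m_ℓ - (ℓ+1) m_{ℓ+1}. -/
theorem exists_abs_moment_one_sub_le :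
    ∃ C : ℝ, 0 ≤ C ∧ ∀ n : ℕ, |moment 1 (n + 1) - moment 1 (n + 1 + 1)| ≤
      C * (contourGap n ^ 2 / ((n : ℝ) + 1)) := by
  obtain ⟨C₀, hC₀, hC⟩ := exists_abs_moment_one_le
  refine ⟨2 * 24 * 64 * Real.sqrt (Real.pi / (1 / 1024)) + C₀, by positivity, fun n => ?_⟩
  have hε0 := contourGap_pos n
  have hε1 := contourGap_le_half n
  obtain ⟨hi, hI⟩ := integral_gaussian_contourGap n (s := 1 / 1024) (by norm_num)
    (2 * 24 * 64 * contourGap n)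
  set r := 1 - contourGap n with hr
  have hr0 : 0 < r := by linarith
  have hr1 : r < 1 := by linarith
  have h := norm_circleIntegral_le_of_le_integrable
    (f := fun v => (diskMap 1 v ^ (n + 1))⁻¹ * (1 / (1 - v) ^ 2) -
      (diskMap 1 v ^ (n + 1 + 1))⁻¹ * (1 / (1 - v) ^ 2)) (c := 0)
    hr0.le hi (fun θ => by
      simp only [Pi.zero_apply]
      positivity) (fun θ hθ => by
      obtain ⟨h1, h2, h3⟩ := norm_contour_integrand_le n hθ
      rw [← hr] at h1 h2 h3
      have hvn : ‖circleMap 0 r θ‖ = r := by rw [norm_circleMap_zero, abs_of_pos hr0]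
      set v := circleMap 0 r θ
      set ε := contourGap n
      have h4 := norm_one_sub_inv_diskMap_one_le (v := v) (by rw [hvn]; linarith) (by rw [hvn]; exact hr1)
      set δ := ‖1 - v‖ with hδ
      have hδ0 : 0 < δ := norm_pos_iff.2 (one_sub_ne_zero_of_norm_lt_one (by rw [hvn]; exact hr1))
      have e : (diskMap 1 v ^ (n + 1))⁻¹ * (1 / (1 - v) ^ 2) -
          (diskMap 1 v ^ (n + 1 + 1))⁻¹ * (1 / (1 - v) ^ 2) =
          (diskMap 1 v ^ (n + 1))⁻¹ * ((1 - (diskMap 1 v)⁻¹) * (1 / (1 - v) ^ 2)) := by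
        rw [pow_succ _ (n + 1), mul_inv]; ring
      have h5 : ‖(1 - (diskMap 1 v)⁻¹) * (1 / (1 - v) ^ 2)‖ ≤ 24 * δ := by
        rw [norm_mul, norm_div, norm_one, norm_pow, ← hδ, mul_one_div, div_le_iff₀ (by positivity)]
        refine h4.trans (le_of_eq (by ring))
      -- Half of the Gaussian decay is spent to replace the factor δ by a multiple of ε.
      have h6 : δ ≤ 64 * ε * Real.exp (δ ^ 2 / (128 * ε ^ 2)) := by
        have h7 := Real.add_one_le_exp (δ ^ 2 / (128 * ε ^ 2))
        refine le_trans ?_ (mul_le_mul_of_nonneg_left h7 (by positivity))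
        have h8 : 64 * ε * (δ ^ 2 / (128 * ε ^ 2) + 1) - δ = ((δ - ε) ^ 2 + 127 * ε ^ 2) / (2 * ε) := by
          field_simp
          ring
        have h9 : 0 ≤ ((δ - ε) ^ 2 + 127 * ε ^ 2) / (2 * ε) := by positivity
        linarith
      rw [e, norm_mul]
      calc ‖(diskMap 1 v ^ (n + 1))⁻¹‖ * ‖(1 - (diskMap 1 v)⁻¹) * (1 / (1 - v) ^ 2)‖
          ≤ (2 * Real.exp (-(δ ^ 2 / (64 * ε ^ 2)))) *
            (24 * (64 * ε * Real.exp (δ ^ 2 / (128 * ε ^ 2)))) := by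
            refine mul_le_mul h3 (h5.trans (by gcongr)) (norm_nonneg _) (by positivity)
        _ = 2 * 24 * 64 * ε * Real.exp (-(δ ^ 2 / (128 * ε ^ 2))) := by
            rw [show -(δ ^ 2 / (128 * ε ^ 2)) = -(δ ^ 2 / (64 * ε ^ 2)) + δ ^ 2 / (128 * ε ^ 2) by
              field_simp; ring, Real.exp_add]
            ring
        _ ≤ _ := by
            gcongr
            rw [neg_mul, neg_le_neg_iff, div_mul_eq_mul_div,
              div_le_div_iff₀ (by positivity) (by positivity)]
            nlinarith [sq_nonneg ε])
  have hv : ∀ v ∈ Metric.sphere (0 : ℂ) r, v ≠ 0 ∧ 1 - v ≠ 0 ∧ 1 + v ≠ 0 := fun v hv => by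
    have hv' : ‖v‖ = r := by simpa using hv
    exact ⟨norm_pos_iff.1 (by rw [hv']; exact hr0),
      one_sub_ne_zero_of_norm_lt_one (by rw [hv']; exact hr1),
      one_add_ne_zero_of_norm_lt_one (by rw [hv']; exact hr1)⟩
  have hint : ∀ l : ℕ, CircleIntegrable (fun v => (diskMap 1 v ^ l)⁻¹ * (1 / (1 - v) ^ 2)) 0 r := by
    intro l
    refine ContinuousOn.circleIntegrable hr0.le (ContinuousOn.mul ?_ ?_)
    · refine ContinuousOn.inv₀ (ContinuousOn.pow (fun v h => ?_) _)
        fun v h => pow_ne_zero _ (diskMap_ne_zero (hv v h).1)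
      exact (hasDerivAt_diskMap 1 (hv v h).2.2).continuousAt.continuousWithinAt
    · exact ContinuousOn.div (by fun_prop) (by fun_prop) fun v h => pow_ne_zero 2 (hv v h).2.1
  rw [circleIntegral.integral_sub (hint _) (hint _), hI] at h
  have h10 : ‖contour 1 (n + 1) 0 r - contour 1 (n + 1 + 1) 0 r‖ ≤ _ := h
  rw [contour_eq_moment_of_lt_one 1 n hr0 hr1, contour_eq_moment_of_lt_one 1 (n + 1) hr0 hr1,
    ← mul_sub, norm_mul] at h10
  have h11 : ‖(((n + 1 : ℕ) : ℂ) * (moment 1 (n + 1) : ℂ) - ((n + 1 + 1 : ℕ) : ℂ) *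
      (moment 1 (n + 1 + 1) : ℂ))‖ = |((n : ℝ) + 1) * moment 1 (n + 1) -
      ((n : ℝ) + 1 + 1) * moment 1 (n + 1 + 1)| := by
    rw [← Real.norm_eq_abs, ← Complex.norm_real]
    push_cast
    rfl
  have h12 : ‖(2 * Real.pi * Complex.I : ℂ)‖ = 2 * Real.pi := by
    simp [abs_of_pos Real.pi_pos]
  rw [h11, h12] at h10
  have hb := hC (n + 1)
  have hmono : contourGap (n + 1) ^ 2 ≤ contourGap n ^ 2 := by
    refine pow_le_pow_left₀ (contourGap_pos _).le ?_ 2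
    rw [contourGap, contourGap]
    refine Real.rpow_le_rpow_of_nonpos (by positivity) ?_ (by norm_num)
    push_cast
    linarith
  set ε := contourGap n
  set S := Real.sqrt (Real.pi / (1 / 1024))
  have hS : 0 ≤ S := Real.sqrt_nonneg _
  set m := moment 1 (n + 1)
  set m' := moment 1 (n + 1 + 1)
  have hn : (0 : ℝ) < (n : ℝ) + 1 := by positivity
  have h13 : |((n : ℝ) + 1) * m - ((n : ℝ) + 1 + 1) * m'| ≤ 2 * 24 * 64 * S * ε ^ 2 := by
    have h14 : r * (2 * 24 * 64 * ε * (S * ε)) ≤ 2 * 24 * 64 * S * ε ^ 2 := by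
      rw [show 2 * 24 * 64 * ε * (S * ε) = 2 * 24 * 64 * S * ε ^ 2 by ring]
      exact mul_le_of_le_one_left (by positivity) hr1.le
    refine le_trans ?_ (h10.trans h14)
    exact le_mul_of_one_le_left (abs_nonneg _) (by linarith [Real.pi_gt_three])
  have h15 : |m'| ≤ C₀ * ε ^ 2 := hb.trans (mul_le_mul_of_nonneg_left hmono hC₀)
  rw [← mul_div_assoc, le_div_iff₀ hn, ← abs_of_pos hn, ← abs_mul]
  -- The weights ℓ and ℓ+1 differ by one, which costs one further moment, itself O(ε^2).
  calc |(m - m') * ((n : ℝ) + 1)| = |(((n : ℝ) + 1) * m - ((n : ℝ) + 1 + 1) * m') + m'| := by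
        congr 1; ring
    _ ≤ _ := abs_add_le _ _
    _ ≤ 2 * 24 * 64 * S * ε ^ 2 + C₀ * ε ^ 2 := add_le_add h13 h15
    _ = _ := by ring

/-! ### Measures on the circle determined by their moments -/

open scoped BoundedContinuousFunction in
-- The star algebra generated by the inclusion of the circle in ℂ separates points and is spanned by
-- the monomials u^k with k an integer.
theorem ext_of_integral_zpow {μ ν : Measure Circle} [IsFiniteMeasure μ] [IsFiniteMeasure ν]
    (h : ∀ k : ℤ, ∫ u : Circle, (u : ℂ) ^ k ∂μ = ∫ u : Circle, (u : ℂ) ^ k ∂ν) : μ = ν := by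
  let e : Circle →ᵇ ℂ := BoundedContinuousFunction.mkOfCompact ⟨fun u => (u : ℂ), by fun_prop⟩
  have hmon : ∀ g ∈ Submonoid.closure ({e} ∪ star {e} : Set (Circle →ᵇ ℂ)),
      ∃ k : ℤ, ∀ u : Circle, g u = (u : ℂ) ^ k := by
    intro g hg
    induction hg using Submonoid.closure_induction with
    | mem x hx =>
      rcases hx with hx | hx
      · exact ⟨1, fun u => by rw [Set.mem_singleton_iff.1 hx, zpow_one]; rfl⟩
      · refine ⟨-1, fun u => ?_⟩
        have hx' : x = star e := by rwa [Set.star_singleton, Set.mem_singleton_iff] at hx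
        rw [hx', BoundedContinuousFunction.star_apply, zpow_neg_one, ← Circle.coe_inv, Circle.coe_inv_eq_conj]
        rfl
    | one => exact ⟨0, fun u => by simp⟩
    | mul x y _ _ hx hy =>
      obtain ⟨k, hk⟩ := hx
      obtain ⟨l, hl⟩ := hy
      refine ⟨k + l, fun u => ?_⟩
      rw [BoundedContinuousFunction.mul_apply, hk, hl, zpow_add₀ (Circle.coe_ne_zero u)]
  refine ext_of_forall_mem_subalgebra_integral_eq_of_polish (𝕜 := ℂ)
    (A := StarAlgebra.adjoin ℂ {e}) ?_ ?_
  · intro x y hxy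
    refine ⟨fun u => (u : ℂ), ⟨_, ⟨e, StarAlgebra.subset_adjoin ℂ _ rfl, rfl⟩, rfl⟩, ?_⟩
    exact fun h => hxy (Circle.ext h)
  · intro g hg
    have hg' : g ∈ Submodule.span ℂ
        (Submonoid.closure ({e} ∪ star {e} : Set (Circle →ᵇ ℂ)) : Set (Circle →ᵇ ℂ)) := by
      rw [← StarAlgebra.adjoin_eq_span]
      exact hg
    clear hg
    induction hg' using Submodule.span_induction with
    | mem x hx =>
      obtain ⟨k, hk⟩ := hmon x hx
      simp only [hk, h]
    | zero => simp
    | add x y _ _ hx hy =>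
      simp only [BoundedContinuousFunction.add_apply]
      rw [integral_add (x.integrable μ) (y.integrable μ), integral_add (x.integrable ν) (y.integrable ν), hx, hy]
    | smul a x _ hx =>
      simp only [BoundedContinuousFunction.smul_apply]
      rw [integral_smul, integral_smul, hx]

theorem ext_of_integral_pow {μ ν : Measure Circle} [IsFiniteMeasure μ] [IsFiniteMeasure ν]
    (h : ∀ k : ℕ, ∫ u : Circle, (u : ℂ) ^ k ∂μ = ∫ u : Circle, (u : ℂ) ^ k ∂ν) : μ = ν := by
  refine ext_of_integral_zpow fun k => ?_
  obtain ⟨n, rfl | rfl⟩ := k.eq_nat_or_neg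
  · simpa using h n
  · have e : ∀ u : Circle, (u : ℂ) ^ (-(n : ℤ)) = (starRingEnd ℂ) ((u : ℂ) ^ n) := fun u => by
      rw [zpow_neg, zpow_natCast, map_pow, ← Circle.coe_inv_eq_conj, Circle.coe_inv, inv_pow]
    simp only [e, integral_conj, h n]

instance : IsFiniteMeasure lengthMeasure := by
  unfold lengthMeasure; infer_instance

theorem integral_lengthMeasure {E : Type*} [NormedAddCommGroup E] [NormedSpace ℝ E] {g : Circle → E}
    (hg : AEStronglyMeasurable g lengthMeasure) :
    ∫ u, g u ∂lengthMeasure = ∫ θ in (-Real.pi)..Real.pi, g (Circle.exp θ) := by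
  rw [intervalIntegral.integral_of_le (by linarith [Real.pi_pos]), lengthMeasure,
    integral_map Circle.exp.continuous.measurable.aemeasurable hg]

theorem integral_zpow_lengthMeasure (k : ℤ) :
    ∫ u : Circle, (u : ℂ) ^ k ∂lengthMeasure = if k = 0 then 2 * (Real.pi : ℂ) else 0 := by
  have hc : Continuous fun u : Circle => (u : ℂ) ^ k :=
    Continuous.zpow₀ (by fun_prop) k fun u => Or.inl (Circle.coe_ne_zero u)
  rw [integral_lengthMeasure hc.aestronglyMeasurable]
  split_ifs with hk
  · subst hk
    simp
    ring
  · have e : ∀ θ : ℝ, ((Circle.exp θ : Circle) : ℂ) ^ k = Complex.exp ((k * Complex.I) * θ) := fun θ => by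
      rw [Circle.coe_exp, ← Complex.exp_int_mul]
      congr 1; ring
    simp only [e]
    have hk' : (k : ℂ) * Complex.I ≠ 0 := mul_ne_zero (by exact_mod_cast hk) Complex.I_ne_zero
    rw [integral_exp_mul_complex hk']
    have : Complex.exp (k * Complex.I * Real.pi) = Complex.exp (k * Complex.I * (-Real.pi : ℝ)) := by
      rw [Complex.exp_eq_exp_iff_exists_int]
      exact ⟨k, by push_cast; ring⟩
    rw [this, sub_self, zero_div]

theorem lengthMeasure_singleton (z : Circle) : lengthMeasure {z} = 0 := by
  rw [lengthMeasure, Measure.map_apply Circle.exp.continuous.measurable (measurableSet_singleton z),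
    Measure.restrict_apply (Circle.exp.continuous.measurable (measurableSet_singleton z))]
  refine Set.Subsingleton.measure_zero ?_ _
  rintro x ⟨hx, hx'⟩ y ⟨hy, hy'⟩
  rw [Set.mem_preimage, Set.mem_singleton_iff] at hx hy
  rw [← Circle.arg_exp hx'.1 hx'.2, ← Circle.arg_exp hy'.1 hy'.2, hx, hy]

theorem lengthMeasure_pos_of_isOpen {U : Set Circle} (hU : IsOpen U) (hne : U.Nonempty) :
    0 < lengthMeasure U := by
  obtain ⟨z, hz⟩ := hne
  set θ := Complex.arg (z : ℂ) with hθ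
  have hz' : Circle.exp θ = z := Circle.exp_arg z
  have hV : IsOpen (Circle.exp ⁻¹' U) := hU.preimage Circle.exp.continuous
  have hθV : θ ∈ Circle.exp ⁻¹' U := by rw [Set.mem_preimage, hz']; exact hz
  obtain ⟨δ, hδ, hball⟩ := Metric.isOpen_iff.1 hV θ hθV
  have h1 : -Real.pi < θ := Complex.neg_pi_lt_arg _
  have h2 : θ ≤ Real.pi := Complex.arg_le_pi _
  rw [lengthMeasure, Measure.map_apply Circle.exp.continuous.measurable hU.measurableSet,
    Measure.restrict_apply hV.measurableSet]
  -- The interval is taken to the left of θ because the argument may equal π.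
  refine lt_of_lt_of_le ?_ (measure_mono (s := Set.Ioo (max (θ - δ) (-Real.pi)) θ) fun x hx => ?_)
  · rw [Real.volume_Ioo, ENNReal.ofReal_pos, sub_pos]
    exact max_lt (by linarith) h1
  · have h3 := (max_lt_iff.1 hx.1)
    refine ⟨hball ?_, h3.2, hx.2.le.trans h2⟩
    rw [Metric.mem_ball, Real.dist_eq, abs_lt]
    constructor <;> linarith [hx.2, h3.1]

/-- Turns almost everywhere positivity of a density into positivity at its points of continuity. -/
theorem nonneg_of_ae_nonneg {f : Circle → ℝ} {z : Circle} (hf : ContinuousAt f z)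
    (h : ∀ᵐ u ∂lengthMeasure, 0 ≤ f u) : 0 ≤ f z := by
  by_contra! hz
  obtain ⟨U, hU, hUo, hzU⟩ := mem_nhds_iff.1 (hf.eventually_lt_const hz)
  refine (lengthMeasure_pos_of_isOpen hUo ⟨z, hzU⟩).ne' ?_
  refine measure_mono_null (fun u hu => ?_) (ae_iff.1 h)
  exact not_le.2 (hU hu)

theorem integral_withDensity_ofReal_mul {f : Circle → ℝ} (hf : Measurable f) (g : Circle → ℂ) :
    ∫ u, g u ∂lengthMeasure.withDensity (fun u => ENNReal.ofReal (f u)) =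
      ∫ u, (max (f u) 0 : ℝ) * g u ∂lengthMeasure := by
  rw [integral_withDensity_eq_integral_toReal_smul (by fun_prop) (by simp)]
  refine integral_congr_ae (Eventually.of_forall fun u => ?_)
  dsimp only
  rw [ENNReal.toReal_ofReal', Complex.real_smul]

theorem integrable_mul_pow {f : Circle → ℝ} (hf : Integrable f lengthMeasure) (k : ℕ) :
    Integrable (fun u : Circle => (f u : ℂ) * (u : ℂ) ^ k) lengthMeasure := by
  refine Integrable.mul_bdd (c := 1) hf.ofReal
    (Continuous.aestronglyMeasurable (by fun_prop)) (Eventually.of_forall fun u => ?_)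
  simp [Circle.norm_coe]

/-- A measure whose moments are those of `c δ_1 + f dθ` is equal to `c δ_1 + f dθ`, and `f` is
almost everywhere nonnegative. -/
theorem eq_dirac_add_withDensity {μ : Measure Circle} [IsFiniteMeasure μ] {f : Circle → ℝ} {c : ℝ}
    (hc : 0 ≤ c) (hf : Measurable f) (hfi : Integrable f lengthMeasure)
    (h : ∀ k : ℕ, ∫ u : Circle, (u : ℂ) ^ k ∂μ = c + ∫ u : Circle, (f u : ℂ) * (u : ℂ) ^ k ∂lengthMeasure) :
    (∀ᵐ u ∂lengthMeasure, 0 ≤ f u) ∧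
    μ = ENNReal.ofReal c • Measure.dirac (1 : Circle) +
      lengthMeasure.withDensity fun u => ENNReal.ofReal (f u) := by
  set P := lengthMeasure.withDensity fun u => ENNReal.ofReal (f u) with hP
  set N := lengthMeasure.withDensity fun u => ENNReal.ofReal (-f u) with hN
  have : IsFiniteMeasure P := isFiniteMeasure_withDensity_ofReal hfi.2
  have : IsFiniteMeasure N := isFiniteMeasure_withDensity_ofReal hfi.neg.2
  have : IsFiniteMeasure (ENNReal.ofReal c • Measure.dirac (1 : Circle)) :=
    Measure.smul_finite _ ENNReal.ofReal_ne_top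
  have hpow : ∀ k : ℕ, Continuous fun u : Circle => (u : ℂ) ^ k := fun k => by fun_prop
  have hint : ∀ (ρ : Measure Circle) [IsFiniteMeasure ρ] (k : ℕ),
      Integrable (fun u : Circle => (u : ℂ) ^ k) ρ := fun ρ _ k =>
    integrable_circle_of_continuous ρ (hpow k)
  -- Moving the negative part of f to the left makes both sides positive finite measures with equal
  -- moments.
  have heq : μ + N = ENNReal.ofReal c • Measure.dirac (1 : Circle) + P := by
    refine ext_of_integral_pow fun k => ?_
    rw [integral_add_measure (hint _ k) (hint _ k), integral_add_measure (hint _ k) (hint _ k), h k,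
      integral_smul_measure, integral_dirac, hP, hN, integral_withDensity_ofReal_mul hf,
      integral_withDensity_ofReal_mul (f := fun u => - f u) hf.neg, ENNReal.toReal_ofReal hc, add_assoc]
    have e1 := integrable_mul_pow (f := fun u => max (f u) 0) hfi.pos_part k
    have e2 := integrable_mul_pow (f := fun u => max (-f u) 0) hfi.neg_part k
    have e3 := integrable_mul_pow hfi k
    rw [← integral_add e3 e2]
    congr 1
    · simp
    · refine integral_congr_ae (Eventually.of_forall fun u => ?_)
      dsimp only
      rw [← add_mul]
      congr 1
      norm_cast
      rcases le_total 0 (f u) with h0 | h0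
      · rw [max_eq_left h0, max_eq_right (by linarith), add_zero]
      · rw [max_eq_right h0, max_eq_left (by linarith), add_neg_cancel]
  -- Neither P nor the atom charges S, so N(S) = 0, although N has positive density there. Removing
  -- 1 is harmless because points have length zero.
  set S : Set Circle := {u | f u < 0} \ {1} with hS
  have hSm : MeasurableSet S := (measurableSet_lt hf measurable_const).diff (measurableSet_singleton 1)
  have hPS : P S = 0 := by
    rw [hP, withDensity_apply _ hSm]
    rw [setLIntegral_congr_fun (g := fun _ => 0) hSm fun u hu => ?_]
    · simp
    · exact ENNReal.ofReal_of_nonpos (le_of_lt hu.1)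
  have hNS : N S = 0 := by
    have h1 : (μ + N) S = 0 := by
      rw [heq, Measure.add_apply, hPS, Measure.smul_apply, Measure.dirac_apply' _ hSm]
      simp [hS]
    rw [Measure.add_apply] at h1
    exact (add_eq_zero.1 h1).2
  have hS0 : lengthMeasure S = 0 := by
    rw [hN, withDensity_apply _ hSm, setLIntegral_eq_zero_iff hSm (by fun_prop)] at hNS
    rw [← compl_compl S, ← mem_ae_iff]
    filter_upwards [hNS] with u hu huS
    have := ENNReal.ofReal_eq_zero.1 (hu huS)
    have h2 : f u < 0 := huS.1
    linarith
  have hae : ∀ᵐ u ∂lengthMeasure, 0 ≤ f u := by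
    rw [ae_iff]
    refine measure_mono_null (t := S ∪ {1}) (fun u hu => ?_)
      (measure_union_null hS0 (lengthMeasure_singleton 1))
    by_cases hu1 : u = 1
    · exact Or.inr hu1
    · exact Or.inl ⟨not_le.1 hu, hu1⟩
  refine ⟨hae, ?_⟩
  have hN0 : N = 0 := by
    rw [hN, withDensity_eq_zero_iff (by fun_prop)]
    filter_upwards [hae] with u hu
    exact ENNReal.ofReal_of_nonpos (by linarith)
  rwa [hN0, add_zero] at heq

/-! ### Cosine series on the circle and summable coefficients -/

/-- Partial sums of the Fourier cosine series on the circle with coefficients `a`. -/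
noncomputable def trigSum (a : ℕ → ℝ) (N : ℕ) (z : Circle) : ℝ :=
  a 0 / (2 * Real.pi) + 1 / Real.pi * ∑ l ∈ Finset.Icc 1 N, a l * ((z : ℂ) ^ l).re

theorem continuous_trigSum (a : ℕ → ℝ) (N : ℕ) : Continuous (trigSum a N) := by
  unfold trigSum
  fun_prop

theorem re_coe_exp_pow (θ : ℝ) (l : ℕ) : (((Circle.exp θ : Circle) : ℂ) ^ l).re = Real.cos (l * θ) := by
  rw [Circle.coe_exp, ← Complex.exp_nat_mul, ← mul_assoc, ← Complex.ofReal_natCast, ← Complex.ofReal_mul,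
    Complex.exp_ofReal_mul_I_re]

theorem integral_pow_mul_re {k l : ℕ} (hl : l ≠ 0) :
    ∫ z : Circle, ((((z : ℂ) ^ l).re : ℝ) : ℂ) * (z : ℂ) ^ k ∂lengthMeasure =
      if l = k then (Real.pi : ℂ) else 0 := by
  have e : ∀ z : Circle, ((((z : ℂ) ^ l).re : ℝ) : ℂ) * (z : ℂ) ^ k =
      1 / 2 * (z : ℂ) ^ ((l : ℤ) + k) + 1 / 2 * (z : ℂ) ^ (-(l : ℤ) + k) := fun z => by
    have hz := Circle.coe_ne_zero z
    rw [Complex.re_eq_add_conj, zpow_add₀ hz, zpow_add₀ hz, zpow_neg, zpow_natCast, zpow_natCast, map_pow,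
      ← Circle.coe_inv_eq_conj, Circle.coe_inv, inv_pow]
    ring
  have hc : ∀ m : ℤ, Continuous fun u : Circle => 1 / 2 * (u : ℂ) ^ m := fun m =>
    continuous_const.mul (Continuous.zpow₀ (by fun_prop) m fun u => Or.inl (Circle.coe_ne_zero u))
  simp only [e]
  rw [integral_add (integrable_circle_of_continuous _ (hc _)) (integrable_circle_of_continuous _ (hc _)),
    integral_const_mul, integral_const_mul, integral_zpow_lengthMeasure, integral_zpow_lengthMeasure,
    if_neg (by omega), mul_zero, zero_add]
  by_cases h : l = k
  · rw [if_pos h, if_pos (by omega)]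
    ring
  · rw [if_neg h, if_neg (by omega), mul_zero]

theorem integral_trigSum_mul_pow (a : ℕ → ℝ) {k N : ℕ} (hk : k ≤ N) :
    ∫ z : Circle, (trigSum a N z : ℂ) * (z : ℂ) ^ k ∂lengthMeasure = a k := by
  have hpi : (Real.pi : ℂ) ≠ 0 := by exact_mod_cast Real.pi_ne_zero
  have e : ∀ z : Circle, (trigSum a N z : ℂ) * (z : ℂ) ^ k =
      ((a 0 / (2 * Real.pi) : ℝ) : ℂ) * (z : ℂ) ^ (k : ℤ) + ∑ l ∈ Finset.Icc 1 N,
        ((1 / Real.pi * a l : ℝ) : ℂ) * (((((z : ℂ) ^ l).re : ℝ) : ℂ) * (z : ℂ) ^ k) := fun z => by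
    rw [trigSum]
    push_cast
    rw [add_mul, zpow_natCast, Finset.mul_sum, Finset.sum_mul]
    congr 1
    exact Finset.sum_congr rfl fun l _ => by ring
  have hc1 : Continuous fun z : Circle => ((a 0 / (2 * Real.pi) : ℝ) : ℂ) * (z : ℂ) ^ (k : ℤ) :=
    continuous_const.mul (Continuous.zpow₀ (by fun_prop) _ fun u => Or.inl (Circle.coe_ne_zero u))
  have hc2 : ∀ l : ℕ, Continuous fun z : Circle =>
      ((1 / Real.pi * a l : ℝ) : ℂ) * (((((z : ℂ) ^ l).re : ℝ) : ℂ) * (z : ℂ) ^ k) := fun l => by fun_prop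
  simp only [e]
  rw [integral_add (integrable_circle_of_continuous _ hc1)
    (integrable_circle_of_continuous _ (continuous_finsetSum _ fun l _ => hc2 l)),
    integral_const_mul, integral_zpow_lengthMeasure,
    integral_finsetSum _ fun l _ => integrable_circle_of_continuous _ (hc2 l)]
  have e2 : ∀ l ∈ Finset.Icc 1 N, ∫ z : Circle,
      ((1 / Real.pi * a l : ℝ) : ℂ) * (((((z : ℂ) ^ l).re : ℝ) : ℂ) * (z : ℂ) ^ k) ∂lengthMeasure =
      if l = k then (a l : ℂ) else 0 := fun l hl => by
    have hl1 := (Finset.mem_Icc.1 hl).1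
    rw [integral_const_mul, integral_pow_mul_re (by omega)]
    split_ifs
    · push_cast
      field_simp
    · rw [mul_zero]
  rw [Finset.sum_congr rfl e2, Finset.sum_ite_eq' (Finset.Icc 1 N) k]
  rcases Nat.eq_zero_or_pos k with rfl | h0
  · simp
  · rw [if_neg (by exact_mod_cast h0.ne'), if_pos (Finset.mem_Icc.2 ⟨h0, hk⟩), mul_zero, zero_add]

/-- Since |z^k| = 1, convergence in L^1 carries Fourier coefficients to the limit, and those of the
partial sums are constant once N ≥ k. -/
theorem integral_mul_pow_of_tendsto {a : ℕ → ℝ} {f : Circle → ℝ} (hf : Integrable f lengthMeasure)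
    (h : Tendsto (fun N => ∫ z, |trigSum a N z - f z| ∂lengthMeasure) atTop (𝓝 0)) (k : ℕ) :
    ∫ z : Circle, (f z : ℂ) * (z : ℂ) ^ k ∂lengthMeasure = a k := by
  have hS : ∀ N, Integrable (trigSum a N) lengthMeasure := fun N =>
    integrable_circle_of_continuous _ (continuous_trigSum a N)
  have hle : ∀ N, ‖(∫ z : Circle, (trigSum a N z : ℂ) * (z : ℂ) ^ k ∂lengthMeasure) -
      ∫ z : Circle, (f z : ℂ) * (z : ℂ) ^ k ∂lengthMeasure‖ ≤
      ∫ z, |trigSum a N z - f z| ∂lengthMeasure := fun N => by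
    rw [← integral_sub (integrable_mul_pow (hS N) k) (integrable_mul_pow hf k)]
    refine (norm_integral_le_integral_norm _).trans (le_of_eq ?_)
    refine integral_congr_ae (Eventually.of_forall fun z => ?_)
    dsimp only
    rw [← sub_mul, norm_mul, norm_pow, Circle.norm_coe, one_pow, mul_one, ← Complex.ofReal_sub,
      Complex.norm_real, Real.norm_eq_abs]
  have h1 : Tendsto (fun N => (∫ z : Circle, (trigSum a N z : ℂ) * (z : ℂ) ^ k ∂lengthMeasure)) atTop
      (𝓝 (∫ z : Circle, (f z : ℂ) * (z : ℂ) ^ k ∂lengthMeasure)) := by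
    rw [tendsto_iff_norm_sub_tendsto_zero]
    exact squeeze_zero (fun _ => norm_nonneg _) hle h
  refine tendsto_nhds_unique h1 (tendsto_const_nhds.congr' ?_)
  filter_upwards [eventually_ge_atTop k] with N hN
  rw [integral_trigSum_mul_pow a hN]

theorem sum_Icc_one_eq_sum_range {M : Type*} [AddCommMonoid M] (g : ℕ → M) (N : ℕ) :
    ∑ l ∈ Finset.Icc 1 N, g l = ∑ n ∈ Finset.range N, g (n + 1) := by
  induction N with
  | zero => simp
  | succ N ih => rw [Finset.sum_Icc_succ_top (by omega), Finset.sum_range_succ, ih]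

theorem exists_continuous_density {μ : Measure Circle} [IsFiniteMeasure μ] {a : ℕ → ℝ} {c : ℝ}
    (hc : 0 ≤ c) (ha : Summable fun n => |a (n + 1)|)
    (h : ∀ k : ℕ, ∫ u : Circle, (u : ℂ) ^ k ∂μ = c + a k) :
    ∃ f : Circle → ℝ, Continuous f ∧ (∀ z, 0 ≤ f z) ∧
      μ = ENNReal.ofReal c • Measure.dirac (1 : Circle) +
        lengthMeasure.withDensity (fun u => ENNReal.ofReal (f u)) ∧
      TendstoUniformly (trigSum a) f atTop := by
  have hb : ∀ (n : ℕ) (z : Circle), ‖a (n + 1) * ((z : ℂ) ^ (n + 1)).re‖ ≤ |a (n + 1)| := fun n z => by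
    rw [norm_mul, Real.norm_eq_abs]
    refine mul_le_of_le_one_right (abs_nonneg _) ?_
    refine (Complex.abs_re_le_norm _).trans ?_
    rw [norm_pow, Circle.norm_coe, one_pow]
  set g : Circle → ℝ := fun z => ∑' n : ℕ, a (n + 1) * ((z : ℂ) ^ (n + 1)).re with hg
  have hgu := tendstoUniformly_tsum_nat ha hb
  have hgc : Continuous g := continuous_tsum (fun n => by fun_prop) ha hb
  set f : Circle → ℝ := fun z => a 0 / (2 * Real.pi) + 1 / Real.pi * g z with hf
  have hfc : Continuous f := by fun_prop
  have hfu : TendstoUniformly (trigSum a) f atTop := by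
    rw [Metric.tendstoUniformly_iff] at hgu ⊢
    intro ε hε
    filter_upwards [hgu (Real.pi * ε) (by positivity)] with N hN z
    have := hN z
    rw [Real.dist_eq] at this ⊢
    rw [hf, trigSum, sum_Icc_one_eq_sum_range]
    dsimp only
    rw [add_sub_add_left_eq_sub, ← mul_sub, abs_mul, abs_of_pos (by positivity), one_div,
      inv_mul_lt_iff₀ Real.pi_pos]
    exact this
  have hfi : Integrable f lengthMeasure := integrable_circle_of_continuous _ hfc
  have hL1 : Tendsto (fun N => ∫ z, |trigSum a N z - f z| ∂lengthMeasure) atTop (𝓝 0) := by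
    rw [show (0 : ℝ) = ∫ z : Circle, (0 : ℝ) ∂lengthMeasure by simp]
    refine tendsto_integral_filter_of_dominated_convergence (fun _ => 1) (Eventually.of_forall fun N =>
      ((continuous_trigSum a N).sub hfc).abs.aestronglyMeasurable) ?_ (integrable_const _) ?_
    · filter_upwards [Metric.tendstoUniformly_iff.1 hfu 1 one_pos] with N hN
      refine Eventually.of_forall fun z => ?_
      have := hN z
      rw [dist_comm, Real.dist_eq] at this
      rw [Real.norm_eq_abs, abs_abs]
      exact this.le
    · refine Eventually.of_forall fun z => ?_
      have := ((hfu.tendsto_at z).sub_const (f z)).abs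
      simpa using this
  obtain ⟨h1, h2⟩ := eq_dirac_add_withDensity hc hfc.measurable hfi fun k => by
    rw [h k, integral_mul_pow_of_tendsto hfi hL1 k]
  exact ⟨f, hfc, fun z => nonneg_of_ae_nonneg hfc.continuousAt h1, h2, hfu⟩

/-! ### Abel summation for coefficients of bounded variation -/

/-- The partial sums `z + z ^ 2 + ... + z ^ N`. -/
noncomputable def geomPartial (z : ℂ) (N : ℕ) : ℂ := ∑ n ∈ Finset.range N, z ^ (n + 1)

theorem sum_mul_pow_eq (a : ℕ → ℝ) (z : ℂ) (N : ℕ) :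
    ∑ n ∈ Finset.range N, (a (n + 1) : ℂ) * z ^ (n + 1) =
      a (N + 1) * geomPartial z N +
        ∑ n ∈ Finset.range N, ((a (n + 1) - a (n + 1 + 1) : ℝ) : ℂ) * geomPartial z (n + 1) := by
  induction N with
  | zero => simp [geomPartial]
  | succ N ih =>
    have e : geomPartial z (N + 1) = geomPartial z N + z ^ (N + 1) := Finset.sum_range_succ _ _
    rw [Finset.sum_range_succ, Finset.sum_range_succ _ N, ih, e]
    push_cast
    ring

theorem geomPartial_eq {z : ℂ} (hz : z ≠ 1) (N : ℕ) :
    geomPartial z N = z / (1 - z) * (1 - z ^ N) := by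
  have h : 1 - z ≠ 0 := sub_ne_zero.2 hz.symm
  have h' : z - 1 ≠ 0 := sub_ne_zero.2 hz
  have e : geomPartial z N = z * ∑ n ∈ Finset.range N, z ^ n := by
    rw [geomPartial, Finset.mul_sum]
    exact Finset.sum_congr rfl fun n _ => pow_succ' z n
  rw [e, geom_sum_eq hz, ← neg_sub 1 z, ← neg_sub 1 (z ^ N), neg_div_neg_eq]
  ring

theorem norm_geomPartial_le (z : Circle) (N : ℕ) : ‖geomPartial z N‖ ≤ N := by
  refine (norm_sum_le _ _).trans (le_of_eq ?_)
  simp [Circle.norm_coe]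

theorem norm_geomPartial_le_div {z : Circle} (hz : z ≠ 1) (N : ℕ) :
    ‖geomPartial z N‖ ≤ 2 / ‖1 - (z : ℂ)‖ := by
  rw [geomPartial_eq (by rwa [Ne, Circle.coe_eq_one]), norm_mul, norm_div, Circle.norm_coe,
    div_mul_eq_mul_div, one_mul]
  gcongr
  refine (norm_sub_le _ _).trans (le_of_eq ?_)
  rw [norm_one, norm_pow, Circle.norm_coe, one_pow]
  norm_num

/-- Interpolates between the trivial bound N and the bound 2/|1-z|, trading growth in N for a weaker
singularity at 1. -/
theorem norm_geomPartial_le_rpow {z : Circle} (hz : z ≠ 1) {γ : ℝ} (h0 : 0 ≤ γ) (h1 : γ ≤ 1) (N : ℕ) :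
    ‖geomPartial z N‖ ≤ (2 / ‖1 - (z : ℂ)‖) ^ γ * (N : ℝ) ^ (1 - γ) := by
  rcases (norm_nonneg (geomPartial z N)).eq_or_lt with h | h
  · rw [← h]; positivity
  · calc ‖geomPartial z N‖ = ‖geomPartial z N‖ ^ γ * ‖geomPartial z N‖ ^ (1 - γ) := by
          rw [← Real.rpow_add h, add_sub_cancel, Real.rpow_one]
      _ ≤ _ := by
          have := norm_geomPartial_le_div hz N
          have h2 := norm_geomPartial_le z N
          have h3 : 0 ≤ 1 - γ := by linarith
          gcongr

/-- The sum of the cosine series with coefficients `a` of bounded variation tending to zero. -/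
noncomputable def seriesLimit (a : ℕ → ℝ) (z : Circle) : ℝ :=
  a 0 / (2 * Real.pi) + 1 / Real.pi * ((z : ℂ) / (1 - z) *
    ∑' n : ℕ, ((a (n + 1) - a (n + 1 + 1) : ℝ) : ℂ) * (1 - (z : ℂ) ^ (n + 1))).re

theorem trigSum_eq_re (a : ℕ → ℝ) (N : ℕ) (z : Circle) :
    trigSum a N z = a 0 / (2 * Real.pi) +
      1 / Real.pi * (∑ n ∈ Finset.range N, (a (n + 1) : ℂ) * (z : ℂ) ^ (n + 1)).re := by
  rw [trigSum, sum_Icc_one_eq_sum_range, Complex.re_sum]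
  congr 2
  exact Finset.sum_congr rfl fun n _ => (Complex.re_ofReal_mul _ _).symm

/-- The series converges uniformly on the whole circle; only the prefactor z/(1-z) is singular, at
1. -/
theorem continuousOn_seriesLimit {a : ℕ → ℝ} (hd : Summable fun n => |a (n + 1) - a (n + 1 + 1)|) :
    ContinuousOn (seriesLimit a) {z : Circle | z ≠ 1} := by
  have h1 : Continuous fun z : Circle =>
      ∑' n : ℕ, ((a (n + 1) - a (n + 1 + 1) : ℝ) : ℂ) * (1 - (z : ℂ) ^ (n + 1)) := by
    refine continuous_tsum (fun n => by fun_prop) (hd.mul_right 2) fun n z => ?_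
    rw [norm_mul, Complex.norm_real, Real.norm_eq_abs]
    gcongr
    refine (norm_sub_le _ _).trans (le_of_eq ?_)
    rw [norm_one, norm_pow, Circle.norm_coe, one_pow]
    norm_num
  have h2 : ContinuousOn (fun z : Circle => (z : ℂ) / (1 - z)) {z : Circle | z ≠ 1} := by
    refine ContinuousOn.div (by fun_prop) (by fun_prop) fun z hz => sub_ne_zero.2 fun h => hz ?_
    exact (Circle.coe_eq_one).1 h.symm
  unfold seriesLimit
  exact continuousOn_const.add (continuousOn_const.mul
    (Complex.continuous_re.comp_continuousOn (h2.mul h1.continuousOn)))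

theorem tendsto_trigSum {a : ℕ → ℝ} (hd : Summable fun n => |a (n + 1) - a (n + 1 + 1)|)
    (ha : Tendsto a atTop (𝓝 0)) {z : Circle} (hz : z ≠ 1) :
    Tendsto (fun N => trigSum a N z) atTop (𝓝 (seriesLimit a z)) := by
  simp only [trigSum_eq_re, seriesLimit]
  refine tendsto_const_nhds.add (tendsto_const_nhds.mul ((Complex.continuous_re.tendsto _).comp ?_))
  simp only [sum_mul_pow_eq]
  rw [← tsum_mul_left, ← zero_add (∑' n : ℕ, _)]
  have hz' : (z : ℂ) ≠ 1 := by rwa [Ne, Circle.coe_eq_one]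
  refine Tendsto.add ?_ ?_
  · rw [tendsto_zero_iff_norm_tendsto_zero]
    have h1 : Tendsto (fun N => |a (N + 1)| * (2 / ‖1 - (z : ℂ)‖)) atTop (𝓝 0) := by
      have := ((ha.comp (tendsto_add_atTop_nat 1)).abs).mul_const (2 / ‖1 - (z : ℂ)‖)
      simpa using this
    refine squeeze_zero (fun _ => norm_nonneg _) (fun N => ?_) h1
    rw [norm_mul, Complex.norm_real, Real.norm_eq_abs]
    exact mul_le_mul_of_nonneg_left (norm_geomPartial_le_div hz N) (abs_nonneg _)
  · have h2 : Summable fun n => ((a (n + 1) - a (n + 1 + 1) : ℝ) : ℂ) * geomPartial z (n + 1) := by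
      refine Summable.of_norm_bounded (hd.mul_right (2 / ‖1 - (z : ℂ)‖)) fun n => ?_
      rw [norm_mul, Complex.norm_real, Real.norm_eq_abs]
      exact mul_le_mul_of_nonneg_left (norm_geomPartial_le_div hz _) (abs_nonneg _)
    have h3 := h2.hasSum.tendsto_sum_nat
    convert! h3 using 2
    refine tsum_congr fun n => ?_
    rw [geomPartial_eq hz']
    ring

/-- After Abel summation the boundary term is of order N^(1/3-γ) and the sum has terms of order
n^(-2/3-γ). Both are controlled because γ > 1/3. -/
theorem exists_abs_trigSum_le {a : ℕ → ℝ} {C γ : ℝ}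
    (ha : ∀ n : ℕ, |a (n + 1)| ≤ C * ((n : ℝ) + 1) ^ (-(2 / 3) : ℝ))
    (hd : ∀ n : ℕ, |a (n + 1) - a (n + 1 + 1)| ≤ C * ((n : ℝ) + 1) ^ (-(5 / 3) : ℝ))
    (hγ : 1 / 3 < γ) (hγ1 : γ ≤ 1) :
    ∃ K : ℝ, 0 ≤ K ∧ ∀ (N : ℕ) (z : Circle), z ≠ 1 →
      |trigSum a N z| ≤ K * (2 / ‖1 - (z : ℂ)‖) ^ γ := by
  have hC : 0 ≤ C := by
    have := (abs_nonneg _).trans (ha 0)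
    simpa using this
  have hs : Summable fun n : ℕ => ((n : ℝ) + 1) ^ (-(2 / 3) - γ) := by
    have := (summable_nat_add_iff 1).2 (Real.summable_nat_rpow.2 (by linarith : -(2 / 3) - γ < -1))
    push_cast at this
    exact this
  set S := ∑' n : ℕ, ((n : ℝ) + 1) ^ (-(2 / 3) - γ) with hS
  have hS0 : 0 ≤ S := tsum_nonneg fun n => by positivity
  refine ⟨|a 0| / (2 * Real.pi) + 1 / Real.pi * (C + C * S), by positivity, fun N z hz => ?_⟩
  have hz' : (z : ℂ) ≠ 1 := by rwa [Ne, Circle.coe_eq_one]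
  have hpos : 0 < ‖1 - (z : ℂ)‖ := norm_pos_iff.2 (sub_ne_zero.2 hz'.symm)
  have hle2 : ‖1 - (z : ℂ)‖ ≤ 2 := by
    refine (norm_sub_le _ _).trans (le_of_eq ?_)
    rw [norm_one, Circle.norm_coe]
    norm_num
  set Q := (2 / ‖1 - (z : ℂ)‖) ^ γ with hQ
  have hQ1 : 1 ≤ Q := Real.one_le_rpow ((one_le_div hpos).2 hle2) (by linarith)
  have hD := norm_geomPartial_le_rpow hz (by linarith : 0 ≤ γ) hγ1
  have hsum : ‖∑ n ∈ Finset.range N, (a (n + 1) : ℂ) * (z : ℂ) ^ (n + 1)‖ ≤ (C + C * S) * Q := by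
    rw [sum_mul_pow_eq]
    refine (norm_add_le _ _).trans ?_
    rw [add_mul]
    refine add_le_add ?_ ?_
    · rw [norm_mul, Complex.norm_real, Real.norm_eq_abs]
      calc |a (N + 1)| * ‖geomPartial z N‖
          ≤ (C * ((N : ℝ) + 1) ^ (-(2 / 3) : ℝ)) * (Q * (N : ℝ) ^ (1 - γ)) := by
            gcongr
            · exact ha N
            · exact hD N
        _ ≤ (C * ((N : ℝ) + 1) ^ (-(2 / 3) : ℝ)) * (Q * ((N : ℝ) + 1) ^ (1 - γ)) := by
            have h3 : 0 ≤ 1 - γ := by linarith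
            gcongr
            linarith
        _ = C * Q * ((N : ℝ) + 1) ^ (1 / 3 - γ) := by
            rw [show 1 / 3 - γ = -(2 / 3) + (1 - γ) by ring, Real.rpow_add (by positivity)]
            ring
        _ ≤ C * Q * 1 := by
            gcongr
            exact Real.rpow_le_one_of_one_le_of_nonpos (by linarith [N.cast_nonneg (α := ℝ)]) (by linarith)
        _ = _ := mul_one _
    · refine (norm_sum_le _ _).trans ?_
      calc ∑ n ∈ Finset.range N, ‖((a (n + 1) - a (n + 1 + 1) : ℝ) : ℂ) * geomPartial z (n + 1)‖
          ≤ ∑ n ∈ Finset.range N, C * Q * ((n : ℝ) + 1) ^ (-(2 / 3) - γ) := by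
            refine Finset.sum_le_sum fun n _ => ?_
            rw [norm_mul, Complex.norm_real, Real.norm_eq_abs]
            have h4 := hD (n + 1)
            push_cast at h4
            calc |a (n + 1) - a (n + 1 + 1)| * ‖geomPartial z (n + 1)‖
                ≤ (C * ((n : ℝ) + 1) ^ (-(5 / 3) : ℝ)) * (Q * ((n : ℝ) + 1) ^ (1 - γ)) := by
                  gcongr
                  exact hd n
              _ = _ := by
                  rw [show -(2 / 3) - γ = -(5 / 3) + (1 - γ) by ring, Real.rpow_add (by positivity)]
                  ring
        _ = C * Q * ∑ n ∈ Finset.range N, ((n : ℝ) + 1) ^ (-(2 / 3) - γ) := by rw [Finset.mul_sum]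
        _ ≤ C * Q * S := by
            gcongr
            exact hs.sum_le_tsum _ fun n _ => by positivity
        _ = _ := by ring
  rw [trigSum_eq_re]
  refine (abs_add_le _ _).trans ?_
  rw [add_mul, abs_div, abs_of_pos (by positivity : 0 < 2 * Real.pi), abs_mul,
    abs_of_pos (by positivity : 0 < 1 / Real.pi), mul_assoc]
  refine add_le_add (le_mul_of_one_le_right (by positivity) hQ1) ?_
  gcongr
  exact (Complex.abs_re_le_norm _).trans hsum

/-! ### Domination and convergence in L^p -/

/-- By Jordan's inequality, |1 - e^(iθ)| = 2|sin(θ/2)| ≥ 2|θ|/π. -/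
theorem two_div_norm_one_sub_exp_le {θ : ℝ} (h0 : θ ≠ 0) (hθ : θ ∈ Set.Icc (-Real.pi) Real.pi) :
    Circle.exp θ ≠ 1 ∧ 2 / ‖1 - ((Circle.exp θ : Circle) : ℂ)‖ ≤ Real.pi / |θ| := by
  have habs : 0 < |θ| := abs_pos.2 h0
  have h1 : ‖1 - ((Circle.exp θ : Circle) : ℂ)‖ = 2 * |Real.sin (θ / 2)| := by
    have h2 : ‖1 - ((Circle.exp θ : Circle) : ℂ)‖ ^ 2 = (2 * |Real.sin (θ / 2)|) ^ 2 := by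
      rw [mul_pow, sq_abs, ← Complex.normSq_eq_norm_sq, Complex.normSq_apply, Circle.coe_exp,
        Complex.sub_re, Complex.sub_im, Complex.exp_ofReal_mul_I_re, Complex.exp_ofReal_mul_I_im,
        Complex.one_re, Complex.one_im]
      have h3 := Real.cos_two_mul (θ / 2)
      rw [mul_div_cancel₀ θ two_ne_zero] at h3
      have h4 := Real.sin_sq_add_cos_sq (θ / 2)
      have h5 := Real.sin_sq_add_cos_sq θ
      linear_combination h5 - 2 * h3 - 4 * h4
    exact (pow_left_inj₀ (norm_nonneg _) (by positivity) two_ne_zero).1 h2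
  have h2 : 2 / Real.pi * |θ| ≤ ‖1 - ((Circle.exp θ : Circle) : ℂ)‖ := by
    have := Real.mul_abs_le_abs_sin (x := θ / 2) (by
      rw [abs_le]; constructor <;> linarith [hθ.1, hθ.2])
    rw [abs_div, abs_of_pos (by norm_num : (0 : ℝ) < 2)] at this
    rw [h1]
    linarith
  have h3 : 0 < 2 / Real.pi * |θ| := by positivity
  refine ⟨fun h => ?_, ?_⟩
  · rw [h, Circle.coe_one, sub_self, norm_zero] at h2
    linarith
  · calc 2 / ‖1 - ((Circle.exp θ : Circle) : ℂ)‖ ≤ 2 / (2 / Real.pi * |θ|) := by gcongr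
      _ = _ := by field_simp

theorem memLp_abs_rpow {γ : ℝ} {p : ℝ≥0∞} (hp1 : 1 ≤ p) (hp : p ≠ ∞) (hγ : γ * p.toReal < 1) (K : ℝ) :
    MemLp (fun θ : ℝ => K * |θ| ^ (-γ)) p (volume.restrict (Set.Icc (-Real.pi) Real.pi)) := by
  refine MemLp.const_mul ?_ K
  have hm : AEStronglyMeasurable (fun θ : ℝ => |θ| ^ (-γ))
      (volume.restrict (Set.Icc (-Real.pi) Real.pi)) := Measurable.aestronglyMeasurable (by fun_prop)
  have hp0 : p ≠ 0 := (zero_lt_one.trans_le hp1).ne'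
  rw [← integrable_norm_rpow_iff hm hp0 hp]
  have e : ∀ θ : ℝ, ‖|θ| ^ (-γ)‖ ^ p.toReal = |θ| ^ (-(γ * p.toReal)) := fun θ => by
    rw [Real.norm_of_nonneg (by positivity), ← Real.rpow_mul (abs_nonneg _), neg_mul]
  simp only [e]
  have h1 : IntervalIntegrable (fun θ : ℝ => |θ| ^ (-(γ * p.toReal))) volume 0 Real.pi := by
    refine (intervalIntegral.intervalIntegrable_rpow' (by linarith : -1 < -(γ * p.toReal))).congr ?_
    intro θ hθ
    rw [Set.uIoc_of_le Real.pi_pos.le] at hθ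
    dsimp only
    rw [abs_of_pos hθ.1]
  have h2 : IntervalIntegrable (fun θ : ℝ => |θ| ^ (-(γ * p.toReal))) volume (-Real.pi) 0 := by
    have := (IntervalIntegrable.iff_comp_neg).1 h1
    simp only [abs_neg, neg_zero] at this
    exact this.symm
  have h3 := h2.trans h1
  rwa [intervalIntegrable_iff_integrableOn_Icc_of_le (by linarith [Real.pi_pos])] at h3

theorem tendsto_eLpNorm_of_dominated {α : Type*} [MeasurableSpace α] {ρ : Measure α} {p : ℝ≥0∞}
    (hp1 : 1 ≤ p) (hp : p ≠ ∞) {F : ℕ → α → ℝ} {f B : α → ℝ} (hF : ∀ n, AEStronglyMeasurable (F n) ρ)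
    (hf : AEStronglyMeasurable f ρ) (hB : MemLp B p ρ) (hFB : ∀ n, ∀ᵐ x ∂ρ, |F n x - f x| ≤ B x)
    (hlim : ∀ᵐ x ∂ρ, Tendsto (fun n => F n x) atTop (𝓝 (f x))) :
    Tendsto (fun n => eLpNorm (fun x => F n x - f x) p ρ) atTop (𝓝 0) := by
  have hp0 : p ≠ 0 := (zero_lt_one.trans_le hp1).ne'
  have hpos : 0 < p.toReal := ENNReal.toReal_pos hp0 hp
  simp only [eLpNorm_eq_lintegral_rpow_enorm_toReal hp0 hp]
  have h1 : Tendsto (fun n => ∫⁻ x, ‖F n x - f x‖ₑ ^ p.toReal ∂ρ) atTop (𝓝 (∫⁻ _, 0 ∂ρ)) := by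
    refine tendsto_lintegral_of_dominated_convergence' (fun x => ‖B x‖ₑ ^ p.toReal)
      (fun n => ((hF n).sub hf).enorm.pow_const _) (fun n => ?_)
      (lintegral_rpow_enorm_lt_top_of_eLpNorm_lt_top hp0 hp hB.2).ne ?_
    · filter_upwards [hFB n] with x hx
      refine ENNReal.rpow_le_rpow ?_ hpos.le
      rw [enorm_le_iff_norm_le, Real.norm_eq_abs, Real.norm_eq_abs]
      exact hx.trans (le_abs_self _)
    · filter_upwards [hlim] with x hx
      have h2 : Tendsto (fun n => ‖F n x - f x‖ₑ) atTop (𝓝 0) := by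
        have := (hx.sub_const (f x)).enorm
        simpa using this
      have h3 := (ENNReal.continuous_rpow_const (y := p.toReal)).continuousAt.tendsto.comp h2
      rwa [ENNReal.zero_rpow_of_pos hpos] at h3
  rw [lintegral_zero] at h1
  have h4 := (ENNReal.continuous_rpow_const (y := 1 / p.toReal)).continuousAt.tendsto.comp h1
  rwa [ENNReal.zero_rpow_of_pos (by positivity)] at h4

/-! ### The three regimes -/

/-- At ℓ = 0 the truncated ℓ - 1 is 0, and the only index (0, 0) is removed by the condition a ≠ 0.
So `moment` also gives the total mass. -/
theorem moment_zero (t : ℝ) : moment t 0 = 1 := by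
  simp [moment, momentPoly, Finset.filter_singleton]

theorem IsFreeUnitaryPoisson.integral_pow_eq {t : ℝ} {μ : Measure Circle}
    (hμ : IsFreeUnitaryPoisson t μ) (k : ℕ) : ∫ u : Circle, (u : ℂ) ^ k ∂μ = (moment t k : ℂ) := by
  have := hμ.isProbabilityMeasure
  cases k with
  | zero => simp [moment_zero]
  | succ n => exact hμ.integral_pow n

theorem cosineSum_eq_trigSum (t : ℝ) (N : ℕ) (θ : ℝ) :
    cosineSum t N θ = trigSum (moment t) N (Circle.exp θ) := by
  simp only [cosineSum, trigSum, moment_zero, re_coe_exp_pow]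
  simp only [moment]

theorem cosineSumStar_eq_trigSum (t : ℝ) (N : ℕ) (θ : ℝ) :
    cosineSumStar t N θ = trigSum (fun l => moment t l - (1 - t)) N (Circle.exp θ) := by
  simp only [cosineSumStar, trigSum, moment_zero, re_coe_exp_pow]
  rw [sub_sub_cancel]
  congr 2
  exact Finset.sum_congr rfl fun l _ => by rw [moment]; ring

theorem IsFreeUnitaryPoisson.density_of_one_lt {t : ℝ} {μ : Measure Circle}
    (hμ : IsFreeUnitaryPoisson t μ) (ht : 1 < t) :
    ∃ f : Circle → ℝ, Continuous f ∧ HasLengthDensity μ f ∧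
      TendstoUniformlyOn (fun (N : ℕ) (θ : ℝ) => cosineSum t N θ)
        (fun θ : ℝ => f (Circle.exp θ)) atTop (Set.Icc (-Real.pi) Real.pi) := by
  have := hμ.isProbabilityMeasure
  obtain ⟨f, hfc, hf0, hfμ, hfu⟩ := exists_continuous_density (μ := μ) (a := moment t) le_rfl
    (summable_moment_of_one_lt ht) fun k => by
      rw [hμ.integral_pow_eq k, Complex.ofReal_zero, zero_add]
  refine ⟨f, hfc, ⟨hfc.measurable, hf0, ?_⟩, ?_⟩
  · rwa [ENNReal.ofReal_zero, zero_smul, zero_add] at hfμ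
  · simp only [cosineSum_eq_trigSum]
    exact (hfu.comp Circle.exp).tendstoUniformlyOn

theorem IsFreeUnitaryPoisson.density_of_lt_one {t : ℝ} {μ : Measure Circle}
    (hμ : IsFreeUnitaryPoisson t μ) (ht0 : 0 < t) (ht1 : t < 1) :
    ∃ (ν : Measure Circle) (f : Circle → ℝ),
      μ = ENNReal.ofReal (1 - t) • Measure.dirac (1 : Circle) + ν ∧ Continuous f ∧
      HasLengthDensity ν f ∧
      TendstoUniformlyOn (fun (N : ℕ) (θ : ℝ) => cosineSumStar t N θ)
        (fun θ : ℝ => f (Circle.exp θ)) atTop (Set.Icc (-Real.pi) Real.pi) := by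
  have := hμ.isProbabilityMeasure
  obtain ⟨f, hfc, hf0, hfμ, hfu⟩ := exists_continuous_density (μ := μ)
    (a := fun l => moment t l - (1 - t)) (c := 1 - t) (by linarith)
    (summable_moment_sub ht0 ht1) fun k => by
      rw [hμ.integral_pow_eq k]
      push_cast
      ring
  refine ⟨_, f, hfμ, hfc, ⟨hfc.measurable, hf0, rfl⟩, ?_⟩
  simp only [cosineSumStar_eq_trigSum]
  exact (hfu.comp Circle.exp).tendstoUniformlyOn

theorem exists_moment_one_bounds : ∃ C : ℝ,
    (∀ n : ℕ, |moment 1 (n + 1)| ≤ C * ((n : ℝ) + 1) ^ (-(2 / 3) : ℝ)) ∧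
    ∀ n : ℕ, |moment 1 (n + 1) - moment 1 (n + 1 + 1)| ≤ C * ((n : ℝ) + 1) ^ (-(5 / 3) : ℝ) := by
  obtain ⟨C₁, hC₁, h₁⟩ := exists_abs_moment_one_le
  obtain ⟨C₂, hC₂, h₂⟩ := exists_abs_moment_one_sub_le
  refine ⟨max C₁ C₂, fun n => (h₁ n).trans ?_, fun n => (h₂ n).trans ?_⟩
  · exact mul_le_mul (le_max_left _ _) (contourGap_sq_le n) (by positivity) (hC₁.trans (le_max_left _ _))
  · refine mul_le_mul (le_max_right _ _) ?_ (by positivity) (hC₁.trans (le_max_left _ _))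
    have hn : (0 : ℝ) < (n : ℝ) + 1 := by positivity
    rw [show (-(5 / 3) : ℝ) = -(2 / 3) - 1 by norm_num, Real.rpow_sub hn, Real.rpow_one]
    gcongr
    exact contourGap_sq_le n

theorem summable_moment_one_sub : Summable fun n => |moment 1 (n + 1) - moment 1 (n + 1 + 1)| := by
  obtain ⟨C, -, h⟩ := exists_moment_one_bounds
  have hs : Summable fun n : ℕ => C * ((n : ℝ) + 1) ^ (-(5 / 3) : ℝ) := by
    have := (summable_nat_add_iff 1).2 (Real.summable_nat_rpow.2 (by norm_num : (-(5 / 3) : ℝ) < -1))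
    push_cast at this
    exact this.mul_left C
  exact hs.of_nonneg_of_le (fun _ => abs_nonneg _) h

theorem tendsto_moment_one : Tendsto (moment 1) atTop (𝓝 0) := by
  obtain ⟨C, h, -⟩ := exists_moment_one_bounds
  refine (tendsto_add_atTop_iff_nat 1).1 (squeeze_zero_norm (a := fun n : ℕ =>
    C * ((n : ℝ) + 1) ^ (-(2 / 3) : ℝ)) h ?_)
  have h1 : Tendsto (fun n : ℕ => (n : ℝ) + 1) atTop atTop :=
    tendsto_atTop_add_const_right _ _ tendsto_natCast_atTop_atTop
  have h2 := ((tendsto_rpow_neg_atTop (by norm_num : (0 : ℝ) < 2 / 3)).comp h1).const_mul C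
  rwa [mul_zero] at h2

theorem measurable_seriesLimit_moment_one : Measurable (seriesLimit (moment 1)) := by
  refine measurable_of_measurable_on_compl_singleton 1 ?_
  exact (continuousOn_iff_continuous_domRestrict.1
    (continuousOn_seriesLimit summable_moment_one_sub)).measurable

theorem ae_restrict_ne_zero : ∀ᵐ θ : ℝ ∂volume.restrict (Set.Icc (-Real.pi) Real.pi),
    θ ≠ 0 ∧ θ ∈ Set.Icc (-Real.pi) Real.pi := by
  refine Filter.Eventually.and (ae_restrict_of_ae ?_) (ae_restrict_mem measurableSet_Icc)
  exact compl_mem_ae_iff.2 (measure_singleton 0)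

theorem tendsto_cosineSum_one {θ : ℝ} (h0 : θ ≠ 0) (hθ : θ ∈ Set.Icc (-Real.pi) Real.pi) :
    Tendsto (fun N => cosineSum 1 N θ) atTop (𝓝 (seriesLimit (moment 1) (Circle.exp θ))) := by
  simp only [cosineSum_eq_trigSum]
  exact tendsto_trigSum summable_moment_one_sub tendsto_moment_one (two_div_norm_one_sub_exp_le h0 hθ).1

theorem memLp_and_tendsto_eLpNorm {p : ℝ≥0∞} (hp1 : 1 ≤ p) (hp3 : p < 3) :
    MemLp (fun θ : ℝ => seriesLimit (moment 1) (Circle.exp θ)) p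
      ((volume : Measure ℝ).restrict (Set.Icc (-Real.pi) Real.pi)) ∧
    Tendsto (fun N : ℕ =>
      eLpNorm (fun θ : ℝ => cosineSum 1 N θ - seriesLimit (moment 1) (Circle.exp θ)) p
        ((volume : Measure ℝ).restrict (Set.Icc (-Real.pi) Real.pi))) atTop (𝓝 0) := by
  have hp : p ≠ ∞ := (hp3.trans (by norm_num)).ne
  have hq1 : 1 ≤ p.toReal := by
    simpa using ENNReal.toReal_mono hp hp1
  have hq3 : p.toReal < 3 := by
    simpa using (ENNReal.toReal_lt_toReal hp (by norm_num)).2 hp3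
  set q := p.toReal with hq
  -- The midpoint of 1/3 and 1/q: γ > 1/3 bounds the partial sums, and γq < 1 puts |θ|^(-γ) in L^q.
  -- Such γ exists because q < 3.
  set γ : ℝ := (1 / 3 + 1 / q) / 2 with hγ
  have hq0 : 0 < q := by linarith
  have h13 : 1 / 3 < 1 / q := one_div_lt_one_div_of_lt hq0 hq3
  have h11 : 1 / q ≤ 1 := by rw [div_le_one hq0]; exact hq1
  have hγ0 : 1 / 3 < γ := by rw [hγ]; linarith
  have hγ1 : γ ≤ 1 := by rw [hγ]; linarith
  have hγq : γ * q < 1 := by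
    rw [← lt_div_iff₀ hq0, hγ]; linarith
  obtain ⟨C, ha, hd⟩ := exists_moment_one_bounds
  obtain ⟨K, hK, hbound⟩ := exists_abs_trigSum_le ha hd hγ0 hγ1
  have hB := memLp_abs_rpow hp1 hp hγq (K * Real.pi ^ γ)
  have hS : ∀ (N : ℕ) (θ : ℝ), θ ≠ 0 → θ ∈ Set.Icc (-Real.pi) Real.pi →
      |cosineSum 1 N θ| ≤ K * Real.pi ^ γ * |θ| ^ (-γ) := fun N θ h0 hθ => by
    obtain ⟨h1, h2⟩ := two_div_norm_one_sub_exp_le h0 hθ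
    rw [cosineSum_eq_trigSum]
    refine (hbound N _ h1).trans ?_
    rw [mul_assoc, Real.rpow_neg (abs_nonneg θ), ← div_eq_mul_inv,
      ← Real.div_rpow Real.pi_pos.le (abs_nonneg θ)]
    have : 0 ≤ γ := by linarith
    gcongr
  have hf : ∀ θ : ℝ, θ ≠ 0 → θ ∈ Set.Icc (-Real.pi) Real.pi →
      |seriesLimit (moment 1) (Circle.exp θ)| ≤ K * Real.pi ^ γ * |θ| ^ (-γ) := fun θ h0 hθ =>
    le_of_tendsto (tendsto_cosineSum_one h0 hθ).abs (Eventually.of_forall fun N => hS N θ h0 hθ)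
  have hfm : AEStronglyMeasurable (fun θ : ℝ => seriesLimit (moment 1) (Circle.exp θ))
      ((volume : Measure ℝ).restrict (Set.Icc (-Real.pi) Real.pi)) :=
    (measurable_seriesLimit_moment_one.comp Circle.exp.continuous.measurable).aestronglyMeasurable
  refine ⟨hB.mono hfm ?_, tendsto_eLpNorm_of_dominated hp1 hp (fun N => ?_) hfm (hB.const_mul 2)
    (fun N => ?_) ?_⟩
  · filter_upwards [ae_restrict_ne_zero] with θ hθ
    rw [Real.norm_eq_abs, Real.norm_eq_abs]
    exact (hf θ hθ.1 hθ.2).trans (le_abs_self _)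
  · refine Continuous.aestronglyMeasurable ?_
    unfold cosineSum
    fun_prop
  · filter_upwards [ae_restrict_ne_zero] with θ hθ
    refine (abs_sub _ _).trans ?_
    linarith [hS N θ hθ.1 hθ.2, hf θ hθ.1 hθ.2]
  · filter_upwards [ae_restrict_ne_zero] with θ hθ
    exact tendsto_cosineSum_one hθ.1 hθ.2

theorem IsFreeUnitaryPoisson.hasLengthDensity_one {μ : Measure Circle}
    (hμ : IsFreeUnitaryPoisson 1 μ) : HasLengthDensity μ (seriesLimit (moment 1)) := by
  have := hμ.isProbabilityMeasure
  have hm := measurable_seriesLimit_moment_one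
  have hexp : Measurable Circle.exp := Circle.exp.continuous.measurable
  obtain ⟨h1, h2⟩ := memLp_and_tendsto_eLpNorm le_rfl (by norm_num)
  have hae : (volume : Measure ℝ).restrict (Set.Icc (-Real.pi) Real.pi) =
      volume.restrict (Set.Ioc (-Real.pi) Real.pi) := Measure.restrict_congr_set Ioc_ae_eq_Icc.symm
  rw [memLp_one_iff_integrable] at h1
  rw [hae] at h1 h2
  have hfi : Integrable (seriesLimit (moment 1)) lengthMeasure :=
    (integrable_map_measure hm.aestronglyMeasurable hexp.aemeasurable).2 h1
  have hL1 : Tendsto (fun N => ∫ z, |trigSum (moment 1) N z - seriesLimit (moment 1) z| ∂lengthMeasure)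
      atTop (𝓝 0) := by
    have h3 := (ENNReal.tendsto_toReal ENNReal.zero_ne_top).comp h2
    rw [ENNReal.toReal_zero] at h3
    refine h3.congr fun N => ?_
    have hmN : AEStronglyMeasurable (fun z => trigSum (moment 1) N z - seriesLimit (moment 1) z)
        lengthMeasure := ((continuous_trigSum _ N).measurable.sub hm).aestronglyMeasurable
    simp only [Function.comp_apply, cosineSum_eq_trigSum]
    rw [eLpNorm_one_eq_lintegral_enorm]
    have h4 := integral_norm_eq_lintegral_enorm hmN
    simp only [Real.norm_eq_abs] at h4
    rw [h4, lengthMeasure, lintegral_map' (by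
      exact hmN.enorm) hexp.aemeasurable]
  obtain ⟨h5, h6⟩ := eq_dirac_add_withDensity (μ := μ) le_rfl hm hfi fun k => by
    rw [hμ.integral_pow_eq k, integral_mul_pow_of_tendsto hfi hL1 k, Complex.ofReal_zero, zero_add]
  refine ⟨hm, fun z => ?_, ?_⟩
  · by_cases hz : z = 1
    -- At z = 1 division by zero makes z/(1-z) vanish, so the density takes the value 1/(2π) there.
    · rw [hz, seriesLimit, moment_zero]
      simp
      positivity
    · exact nonneg_of_ae_nonneg ((continuousOn_seriesLimit summable_moment_one_sub).continuousAt
        (isOpen_ne.mem_nhds hz)) h5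
  · rwa [ENNReal.ofReal_zero, zero_smul, zero_add] at h6

end FreeUnitaryPoisson

theorem mainTheorem11 (t : ℝ) (μ : Measure Circle)
    (hμ : FreeUnitaryPoisson.IsFreeUnitaryPoisson t μ) :
    (1 < t →
      ∃ f : Circle → ℝ, Continuous f ∧
        FreeUnitaryPoisson.HasLengthDensity μ f ∧
        TendstoUniformlyOn (fun (N : ℕ) (θ : ℝ) => FreeUnitaryPoisson.cosineSum t N θ)
          (fun θ : ℝ => f (Circle.exp θ)) atTop (Set.Icc (-Real.pi) Real.pi)) ∧
    (0 < t → t < 1 →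
      ∃ (ν : Measure Circle) (f : Circle → ℝ),
        μ = ENNReal.ofReal (1 - t) • Measure.dirac (1 : Circle) + ν ∧
        Continuous f ∧
        FreeUnitaryPoisson.HasLengthDensity ν f ∧
        TendstoUniformlyOn (fun (N : ℕ) (θ : ℝ) => FreeUnitaryPoisson.cosineSumStar t N θ)
          (fun θ : ℝ => f (Circle.exp θ)) atTop (Set.Icc (-Real.pi) Real.pi)) ∧
    (t = 1 →
      ∃ f : Circle → ℝ, ContinuousOn f {z : Circle | z ≠ 1} ∧
        FreeUnitaryPoisson.HasLengthDensity μ f ∧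
        (∀ θ ∈ Set.Icc (-Real.pi) Real.pi, θ ≠ 0 →
          Tendsto (fun N : ℕ => FreeUnitaryPoisson.cosineSum t N θ) atTop
            (𝓝 (f (Circle.exp θ)))) ∧
        (∀ p : ℝ≥0∞, 1 ≤ p → p < 3 →
          MemLp (fun θ : ℝ => f (Circle.exp θ)) p
            ((volume : Measure ℝ).restrict (Set.Icc (-Real.pi) Real.pi)) ∧
          Tendsto (fun N : ℕ =>
            eLpNorm (fun θ : ℝ => FreeUnitaryPoisson.cosineSum t N θ - f (Circle.exp θ)) p
              ((volume : Measure ℝ).restrict (Set.Icc (-Real.pi) Real.pi))) atTop (𝓝 0))) := by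
  refine ⟨hμ.density_of_one_lt, hμ.density_of_lt_one, ?_⟩
  rintro rfl
  exact ⟨_, FreeUnitaryPoisson.continuousOn_seriesLimit FreeUnitaryPoisson.summable_moment_one_sub,
    hμ.hasLengthDensity_one, fun θ hθ h0 => FreeUnitaryPoisson.tendsto_cosineSum_one h0 hθ,
    fun p hp1 hp3 => FreeUnitaryPoisson.memLp_and_tendsto_eLpNorm hp1 hp3⟩
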